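/- Let $K$ be a commutative ring with unit, and write $\mathrm{gl.dim}\,R$ for the left global dimension of a ring $R$, i.e. the supremum (possibly $\infty$) of the projective dimensions of all left $R$-modules. A monoid $M$ is (von Neumann) regular if for every $s\in M$ there is $t\in M$ with $sts=s$. For an idempotent $e\in M$, let $G_e$ denote the maximal subgroup of $M$ at $e$, that is, the group of units of the monoid $eMe$ (with identity $e$). If $M$ has a zero element $z$, let $K_{0}M=KM/Kz$ denote its contracted monoid algebra. An ideal of $M$ is a nonempty subset $I$ with $MI\cup IM\subseteq I$, and a principal series of $M$ is an unrefinable chain of ideals $I_n\subsetneq\cdots\subsetneq I_1\subsetneq I_0=M$. (a) Let $M$ be a finite nontrivial regular monoid with zero, and let $e_0,\dots,e_n\in M$ be idempotents such that $$0=Me_nM\subsetneq\cdots\subsetneq Me_1M\subsetneq Me_0M=M$$ is a principal series of $M$. If $|G_{e_i}|$ is not a unit in $K$ for some $i$, then $\mathrm{gl.dim}\,K_0M=\infty$. Otherwise, $\mathrm{gl.dim}\,K_0M\le 2(n-1)+n\cdot\mathrm{gl.dim}\,K$. (b) Let $M$ be a finite regular monoid (not necessarily with zero). Then the monoid algebra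 $KM$ has finite left global dimension if and only if $K$ has finite global dimension and $|G_e|$ is a unit in $K$ for every idempotent $e\in M$. -/

import Mathlib

/-- A monoid is (von Neumann) regular if every `s` satisfies `s * t * s = s` for some `t`. -/
def IsRegularMonoid (M : Type*) [Monoid M] : Prop :=
  ∀ s : M, ∃ t : M, s * t * s = s

/-- A (two-sided) ideal of a monoid: a nonempty subset `I` with `M I ∪ I M ⊆ I`. -/
structure IsMonoidIdeal {M : Type*} [Monoid M] (I : Set M) : Prop where
  nonempty : I.Nonempty
  mul_mem_left : ∀ (m : M) {x : M}, x ∈ I → m * x ∈ I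
  mul_mem_right : ∀ (m : M) {x : M}, x ∈ I → x * m ∈ I

/-- The principal ideal `M a M`. -/
def principalIdeal {M : Type*} [Monoid M] (a : M) : Set M :=
  {x | ∃ m m' : M, x = m * a * m'}

/-- `I n ⊊ ⋯ ⊊ I 1 ⊊ I 0 = M` is an unrefinable chain of two-sided ideals of `M`: an ideal that is
comparable with all members of the chain is itself a member of the chain. -/
structure IsPrincipalSeries {M : Type*} [Monoid M] {n : ℕ} (I : Fin (n + 1) → Set M) : Prop where
  isIdeal : ∀ i, IsMonoidIdeal (I i)
  zero_eq : I 0 = Set.univ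
  strictAnti : StrictAnti I
  unrefinable : ∀ J : Set M, IsMonoidIdeal J → (∀ i, J ⊆ I i ∨ I i ⊆ J) → ∃ i, J = I i

/-- The local monoid `e M e` (as a type) of an idempotent `e`. -/
def LocalMonoid {M : Type*} [Monoid M] {e : M} (_ : IsIdempotentElem e) : Type _ :=
  Subsemigroup.corner e

/-- `e M e` is a monoid under the multiplication of `M`, with identity `e`. -/
instance LocalMonoid.instMonoid {M : Type*} [Monoid M] {e : M} (he : IsIdempotentElem e) :
    Monoid (LocalMonoid he) where
  __ : Semigroup (LocalMonoid he) := inferInstanceAs <| Semigroup (Subsemigroup.corner e)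
  one := ⟨e, e, by simp only [he.eq]⟩
  one_mul r := Subtype.ext ((Subsemigroup.mem_corner_iff he).mp r.2).1
  mul_one r := Subtype.ext ((Subsemigroup.mem_corner_iff he).mp r.2).2

/-- The maximal subgroup `G_e` at an idempotent `e`: the group of units of `e M e`. -/
abbrev MaximalSubgroup {M : Type*} [Monoid M] {e : M} (he : IsIdempotentElem e) : Type _ :=
  (LocalMonoid he)ˣ

/-- The ideal `K z` of the monoid algebra `K M`, where `z` is the zero element of `M`. -/
noncomputable def zeroIdeal (K M : Type*) [CommRing K] [MonoidWithZero M] :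
    Ideal (MonoidAlgebra K M) where
  carrier := Set.range fun k : K => MonoidAlgebra.single (0 : M) k
  add_mem' := by
    rintro _ _ ⟨a, rfl⟩ ⟨b, rfl⟩
    exact ⟨a + b, MonoidAlgebra.single_add _ _ _⟩
  zero_mem' := ⟨0, MonoidAlgebra.single_zero _⟩
  smul_mem' := by
    rintro c _ ⟨a, rfl⟩
    induction c using MonoidAlgebra.induction_linear with
    | zero => exact ⟨0, by simp⟩
    | add f g hf hg =>
      obtain ⟨x, hx⟩ := hf
      obtain ⟨y, hy⟩ := hg
      refine ⟨x + y, ?_⟩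
      simp only [smul_eq_mul] at hx hy ⊢
      rw [add_mul, ← hx, ← hy]
      exact MonoidAlgebra.single_add _ _ _
    | single m b => exact ⟨b * a, by simp [MonoidAlgebra.single_mul_single]⟩

instance zeroIdeal.instIsTwoSided (K M : Type*) [CommRing K] [MonoidWithZero M] :
    (zeroIdeal K M).IsTwoSided where
  mul_mem_of_left := by
    rintro _ c ⟨a, rfl⟩
    induction c using MonoidAlgebra.induction_linear with
    | zero => exact ⟨0, by simp⟩
    | add f g hf hg => rw [mul_add]; exact add_mem hf hg
    | single m b => exact ⟨a * b, by simp [MonoidAlgebra.single_mul_single]⟩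

/-- The contracted monoid algebra `K₀M = KM / Kz`, where `z` is the zero element of `M`. -/
abbrev ContractedMonoidAlgebra (K M : Type*) [CommRing K] [MonoidWithZero M] : Type _ :=
  MonoidAlgebra K M ⧸ zeroIdeal K M

universe w u v

/-- The left global dimension of `R`: the supremum of the projective dimensions of all left
`R`-modules (living in `Type (max u w)`, where `R : Type u`). The projective dimension of the zero
module is `⊥`, so the global dimension of a nontrivial ring is a natural number or `⊤`, and that of
the zero ring is `⊥`. -/
noncomputable def leftGlobalDimension (R : Type u) [Ring R] : WithBot ℕ∞ :=
  ⨆ X : ModuleCat.{max u w} R, CategoryTheory.projectiveDimension X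

-- Write A for K₀M or KM. For an idempotent f let Δ_f (`standard`) be Af modulo the span of the
-- elements of Mf that generate smaller left ideals. It is projective over K, and G_f acts on it
-- from the right. By regularity every principal left ideal has an idempotent generator, so any left
-- ideal of A spanned by a left stable subset of M is filtered by modules Δ_f; this survives
-- tensoring with a K-module V (`filtration_induction`).
--
-- Upper bound. Af is projective and the kernel of Af → Δ_f is filtered by standard modules deeper
-- in M, so the projective dimension of Δ_f ⊗ V is at most the number of nonzero levels below f plus
-- that of V. Let X be killed by everything deeper than e. The action map Δ_e ⊗ X → X becomes, after
-- averaging over G_e (this uses that |G_e| is a unit), a map from a direct summand of Δ_e ⊗ X whose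
-- kernel and cokernel are killed by e as well (`average_smul`). Induction on the level, each
-- costing one dimension, gives 2(n-1) + gl.dim K (`hasProjectiveDimensionLT_of_depth`), which is at
-- most the stated bound.
--
-- Lower bound. Let g ∈ G_e have prime order p, and let γ be right multiplication by g on Δ_e. Since
-- ⟨g⟩ permutes the basis of Δ_e freely, γ - 1 and the norm N = 1 + γ + ⋯ + γ^(p-1) form a
-- two-periodic exact sequence. Moreover Ext^i(Δ_e, Y) = 0 for i > 0 and Y ⊆ Δ_e
-- (`subsingleton_ext_standard_self`). If projective dimensions are bounded, dimension shifting
-- around the period makes ker N a direct summand, and comparing coefficients at e then exhibits an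
-- inverse of p in K (`isUnit_orderOf_of_projection`). Cauchy's theorem does the rest.
--
-- For KM the same arguments apply with empty zero set, and K inherits finite global dimension
-- because V is a K-linear retract of A ⊗ V.

universe t

/-! ### Projective dimension and Ext along short exact sequences -/

section HomologicalAlgebra

open CategoryTheory Abelian TensorProduct

section ShortExact

variable {R : Type u} [Ring R] {X₁ X₂ X₃ : Type t} [AddCommGroup X₁] [AddCommGroup X₂]
  [AddCommGroup X₃] [Module R X₁] [Module R X₂] [Module R X₃]
  {f : X₁ →ₗ[R] X₂} {g : X₂ →ₗ[R] X₃}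

theorem shortExact_of_linearMap (hf : Function.Injective f) (hfg : Function.Exact f g)
    (hg : Function.Surjective g) :
    (ModuleCat.shortComplexOfCompEqZero f g hfg.linearMap_comp_eq_zero).ShortExact :=
  ModuleCat.shortComplex_shortExact _ hfg hf hg

/-- A short exact sequence `0 → X₁ → X₂ → X₃ → 0` of modules bounds the projective dimension
of the middle term. -/
theorem hasProjectiveDimensionLT_middle (hf : Function.Injective f) (hfg : Function.Exact f g)
    (hg : Function.Surjective g) {n : ℕ} (h₁ : HasProjectiveDimensionLT (ModuleCat.of R X₁) n)
    (h₃ : HasProjectiveDimensionLT (ModuleCat.of R X₃) n) :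
    HasProjectiveDimensionLT (ModuleCat.of R X₂) n :=
  (shortExact_of_linearMap hf hfg hg).hasProjectiveDimensionLT_X₂ n h₁ h₃

theorem hasProjectiveDimensionLT_right (hf : Function.Injective f) (hfg : Function.Exact f g)
    (hg : Function.Surjective g) {n : ℕ} (h₁ : HasProjectiveDimensionLT (ModuleCat.of R X₁) n)
    (h₂ : HasProjectiveDimensionLT (ModuleCat.of R X₂) (n + 1)) :
    HasProjectiveDimensionLT (ModuleCat.of R X₃) (n + 1) :=
  (shortExact_of_linearMap hf hfg hg).hasProjectiveDimensionLT_X₃ n h₁ h₂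

theorem hasProjectiveDimensionLT_left (hf : Function.Injective f) (hfg : Function.Exact f g)
    (hg : Function.Surjective g) {n : ℕ} (h₂ : HasProjectiveDimensionLT (ModuleCat.of R X₂) n)
    (h₃ : HasProjectiveDimensionLT (ModuleCat.of R X₃) (n + 1)) :
    HasProjectiveDimensionLT (ModuleCat.of R X₁) n :=
  (shortExact_of_linearMap hf hfg hg).hasProjectiveDimensionLT_X₁ n h₂ h₃

theorem hasProjectiveDimensionLT_mono {n m : ℕ} (h : HasProjectiveDimensionLT (ModuleCat.of R X₁) n)
    (hnm : n ≤ m) : HasProjectiveDimensionLT (ModuleCat.of R X₁) m :=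
  hasProjectiveDimensionLT_of_ge _ n m hnm

theorem hasProjectiveDimensionLT_retract {i : X₁ →ₗ[R] X₂} {r : X₂ →ₗ[R] X₁}
    (hri : r ∘ₗ i = LinearMap.id) {n : ℕ}
    (h : HasProjectiveDimensionLT (ModuleCat.of R X₂) n) :
    HasProjectiveDimensionLT (ModuleCat.of R X₁) n :=
  Retract.hasProjectiveDimensionLT (X := ModuleCat.of R X₁) (Y := ModuleCat.of R X₂)
    ⟨ModuleCat.ofHom i, ModuleCat.ofHom r, by
      rw [← ModuleCat.ofHom_comp, hri]; rfl⟩ n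

theorem hasProjectiveDimensionLT_of_subsingleton [Subsingleton X₁] (n : ℕ) :
    HasProjectiveDimensionLT (ModuleCat.of R X₁) n := by
  have := (ModuleCat.isZero_of_iff_subsingleton (R := R) (M := X₁)).2
    inferInstance |>.hasProjectiveDimensionLT_zero
  exact hasProjectiveDimensionLT_of_ge _ 0 n (Nat.zero_le n)

/-- If `α : X₁ → X₂` is compatible with an idempotent `π` on `X₁`, then the projective dimension of
`X₂` is controlled by those of `X₁`, the part of the kernel of `α` fixed by `π`, and the
cokernel of `α`. -/
theorem hasProjectiveDimensionLT_of_idempotent (α : X₁ →ₗ[R] X₂) (π : X₁ →ₗ[R] X₁)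
    (hππ : ∀ s, π (π s) = π s) (hαπ : ∀ s, α (π s) = α s) {k k' : ℕ} (hk : k + 1 ≤ k')
    (h₁ : HasProjectiveDimensionLT (ModuleCat.of R X₁) k')
    (hker : HasProjectiveDimensionLT
      (ModuleCat.of R (LinearMap.range π ⊓ LinearMap.ker α : Submodule R X₁)) k)
    (hcok : HasProjectiveDimensionLT (ModuleCat.of R (X₂ ⧸ LinearMap.range α)) k) :
    HasProjectiveDimensionLT (ModuleCat.of R X₂) k' := by
  have hT : HasProjectiveDimensionLT (ModuleCat.of R (LinearMap.range π)) k' := by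
    refine hasProjectiveDimensionLT_retract (i := (LinearMap.range π).subtype)
      (r := π.rangeRestrict) (LinearMap.ext ?_) h₁
    rintro ⟨_, s, rfl⟩
    exact Subtype.ext (hππ s)
  -- As α ∘ π = α, the summand `range π` maps onto `range α` with kernel `range π ⊓ ker α`; passing
  -- to this quotient is what costs the one in `k + 1 ≤ k'`.
  have hrange : HasProjectiveDimensionLT (ModuleCat.of R (LinearMap.range α)) k' := by
    obtain ⟨j, rfl⟩ : ∃ j, k' = j + 1 := ⟨k' - 1, by omega⟩
    refine hasProjectiveDimensionLT_right
      (f := Submodule.inclusion (inf_le_left : LinearMap.range π ⊓ LinearMap.ker α ≤ _))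
      (g := α.rangeRestrict ∘ₗ (LinearMap.range π).subtype)
      (Submodule.inclusion_injective _) (fun x => ?_) ?_
      (hasProjectiveDimensionLT_mono hker (by omega)) hT
    · refine ⟨fun h => ⟨⟨x, x.2, congrArg Subtype.val h⟩, rfl⟩, ?_⟩
      rintro ⟨y, rfl⟩
      exact Subtype.ext y.2.2
    · rintro ⟨_, s, rfl⟩
      exact ⟨⟨π s, s, rfl⟩, Subtype.ext (hαπ s)⟩
  exact hasProjectiveDimensionLT_middle (f := (LinearMap.range α).subtype)
    (g := (LinearMap.range α).mkQ) (Submodule.injective_subtype _)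
    (LinearMap.exact_subtype_mkQ _) (Submodule.mkQ_surjective _) hrange
    (hasProjectiveDimensionLT_mono hcok (by omega))

variable [Small.{t} R]

theorem hasProjectiveDimensionLT_one_iff :
    HasProjectiveDimensionLT (ModuleCat.of R X₁) 1 ↔ Module.Projective R X₁ := by
  rw [← projective_iff_hasProjectiveDimensionLT_one, ← IsProjective.iff_projective]

theorem hasProjectiveDimensionLT_of_projective [Module.Projective R X₁] {n : ℕ} (hn : 1 ≤ n) :
    HasProjectiveDimensionLT (ModuleCat.of R X₁) n := by
  have := (hasProjectiveDimensionLT_one_iff (R := R) (X₁ := X₁)).2 inferInstance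
  exact hasProjectiveDimensionLT_of_ge _ 1 n hn

variable {Y : ModuleCat.{t} R}

theorem subsingleton_ext_middle (hf : Function.Injective f) (hfg : Function.Exact f g)
    (hg : Function.Surjective g) {n : ℕ} (h₁ : Subsingleton (Ext (ModuleCat.of R X₁) Y n))
    (h₃ : Subsingleton (Ext (ModuleCat.of R X₃) Y n)) :
    Subsingleton (Ext (ModuleCat.of R X₂) Y n) := by
  refine subsingleton_of_forall_eq 0 fun x => ?_
  obtain ⟨y, rfl⟩ := Ext.contravariant_sequence_exact₂ (shortExact_of_linearMap hf hfg hg) Y x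
    (h₁.elim _ _)
  rw [h₃.elim y 0, Ext.comp_zero]

theorem subsingleton_ext_right (hf : Function.Injective f) (hfg : Function.Exact f g)
    (hg : Function.Surjective g) {n : ℕ} (h₁ : Subsingleton (Ext (ModuleCat.of R X₁) Y n))
    (h₂ : Subsingleton (Ext (ModuleCat.of R X₂) Y (n + 1))) :
    Subsingleton (Ext (ModuleCat.of R X₃) Y (n + 1)) := by
  refine subsingleton_of_forall_eq 0 fun x => ?_
  obtain ⟨y, rfl⟩ := Ext.contravariant_sequence_exact₃ (shortExact_of_linearMap hf hfg hg) Y x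
    (h₂.elim _ _) (add_comm 1 n)
  rw [h₁.elim y 0, Ext.comp_zero]

theorem subsingleton_ext_left (hf : Function.Injective f) (hfg : Function.Exact f g)
    (hg : Function.Surjective g) {n : ℕ} (h₂ : Subsingleton (Ext (ModuleCat.of R X₂) Y n))
    (h₃ : Subsingleton (Ext (ModuleCat.of R X₃) Y (n + 1))) :
    Subsingleton (Ext (ModuleCat.of R X₁) Y n) := by
  refine subsingleton_of_forall_eq 0 fun x => ?_
  obtain ⟨y, rfl⟩ := Ext.contravariant_sequence_exact₁ (shortExact_of_linearMap hf hfg hg) Y x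
    (add_comm 1 n) (h₃.elim _ _)
  rw [h₂.elim y 0, Ext.comp_zero]

theorem subsingleton_ext_zero (h : ∀ φ : X₁ →ₗ[R] Y, φ = 0) :
    Subsingleton (Ext (ModuleCat.of R X₁) Y 0) := by
  refine Ext.homEquiv₀.subsingleton_congr.2 (subsingleton_of_forall_eq 0 fun φ => ?_)
  ext x
  simp [h φ.hom]

/-- The obstruction to extending the identity of X₁ along f lies in Ext¹(X₃, X₁). -/
theorem exists_retraction_of_subsingleton_ext (hf : Function.Injective f)
    (hfg : Function.Exact f g) (hg : Function.Surjective g)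
    (h : Subsingleton (Ext (ModuleCat.of R X₃) (ModuleCat.of R X₁) 1)) :
    ∃ r : X₂ →ₗ[R] X₁, r ∘ₗ f = LinearMap.id := by
  obtain ⟨x, hx⟩ := Ext.contravariant_sequence_exact₁ (shortExact_of_linearMap hf hfg hg)
    (ModuleCat.of R X₁) (Ext.mk₀ (𝟙 _)) (add_comm 1 0) (h.elim _ _)
  obtain ⟨r, rfl⟩ := Ext.homEquiv₀.symm.surjective x
  refine ⟨r.hom, ?_⟩
  have := Ext.homEquiv₀.symm.injective (a₁ := ModuleCat.ofHom f ≫ r) (a₂ := 𝟙 _)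
    (by simpa using hx)
  exact congrArg ModuleCat.Hom.hom this

end ShortExact

/-- Let `φ, ψ` be endomorphisms of `D` that form a two-periodic exact sequence. If all modules have
bounded projective dimension and `Ext D (ker φ)` vanishes in positive degrees, then `ker φ` is a
direct summand of `D`. -/
theorem exists_projection_ker_of_periodic {R : Type u} [Ring R] [Small.{t} R] {D : Type t}
    [AddCommGroup D] [Module R D] {φ ψ : D →ₗ[R] D}
    (hφ : LinearMap.ker φ = LinearMap.range ψ) (hψ : LinearMap.ker ψ = LinearMap.range φ)
    {d : ℕ} (hd : ∀ X : ModuleCat.{t} R, HasProjectiveDimensionLT X d)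
    (hD : ∀ n, Subsingleton (Ext (ModuleCat.of R D) (ModuleCat.of R (LinearMap.ker φ)) (n + 1))) :
    ∃ r : D →ₗ[R] D, (∀ x, φ (r x) = 0) ∧ ∀ x, φ x = 0 → r x = x := by
  -- Descending induction on the degree: since Ext^(n+1)(D, -) vanishes on ker φ, the sequence ker →
  -- D → image embeds Ext^(n+1) of one kernel into Ext^(n+2) of the other.
  have key : ∀ k n, d ≤ n + k →
      Subsingleton (Ext (ModuleCat.of R (LinearMap.ker φ)) (ModuleCat.of R (LinearMap.ker φ))
        (n + 1)) ∧
      Subsingleton (Ext (ModuleCat.of R (LinearMap.ker ψ)) (ModuleCat.of R (LinearMap.ker φ))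
        (n + 1)) := by
    intro k
    induction k with
    | zero =>
      intro n hn
      exact ⟨HasProjectiveDimensionLT.subsingleton (hX := hd _) _ d _ (by omega) _,
        HasProjectiveDimensionLT.subsingleton (hX := hd _) _ d _ (by omega) _⟩
    | succ k ih =>
      intro n hn
      obtain ⟨h₁, h₂⟩ := ih (n + 1) (by omega)
      constructor
      · refine subsingleton_ext_left (f := (LinearMap.ker φ).subtype) (g := φ.rangeRestrict)
          (Submodule.injective_subtype _) (fun x => ?_) φ.surjective_rangeRestrict (hD n) ?_
        · simp [Subtype.ext_iff]
        · rwa [← hψ]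
      · refine subsingleton_ext_left (f := (LinearMap.ker ψ).subtype) (g := ψ.rangeRestrict)
          (Submodule.injective_subtype _) (fun x => ?_) ψ.surjective_rangeRestrict (hD n) ?_
        · simp [Subtype.ext_iff]
        · rwa [← hφ]
  obtain ⟨r, hr⟩ := exists_retraction_of_subsingleton_ext (f := (LinearMap.ker φ).subtype)
    (g := φ.rangeRestrict) (Submodule.injective_subtype _)
    (fun x => by simp [Subtype.ext_iff]) φ.surjective_rangeRestrict
    (by rw [← hψ]; exact (key d 0 (by omega)).2)
  refine ⟨(LinearMap.ker φ).subtype ∘ₗ r, fun x => (r x).2, fun x hx => ?_⟩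
  exact congrArg Subtype.val (LinearMap.congr_fun hr ⟨x, hx⟩)

/-! ### Tensoring with K-modules and restriction of scalars -/

section Tensor

section

variable {K A : Type*} [CommRing K] [Ring A] [Algebra K A]
variable {N₁ N₂ N₃ V : Type*} [AddCommGroup N₁] [AddCommGroup N₂]
  [AddCommGroup N₃] [AddCommGroup V] [Module K V] [Module K N₁] [Module K N₂] [Module K N₃]
  [Module A N₁] [Module A N₂] [Module A N₃] [IsScalarTower K A N₁] [IsScalarTower K A N₂]
  [IsScalarTower K A N₃] {f : N₁ →ₗ[A] N₂} {g : N₂ →ₗ[A] N₃}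

variable (V) in
-- V need not be flat, so injectivity is secured by a retraction, which only has to be K-linear.
theorem rTensor_injective_of_retraction (s : N₂ →ₗ[K] N₁) (hs : ∀ x, s (f x) = x) :
    Function.Injective (AlgebraTensorModule.rTensor K V f) := by
  refine Function.LeftInverse.injective (g := s.rTensor V) fun x => ?_
  change (s.rTensor V) ((f.restrictScalars K).rTensor V x) = x
  rw [← LinearMap.comp_apply, ← LinearMap.rTensor_comp,
    show s ∘ₗ f.restrictScalars K = LinearMap.id from LinearMap.ext hs]
  simp

variable (V) in
theorem rTensor_surjective_algebra (hg : Function.Surjective g) :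
    Function.Surjective (AlgebraTensorModule.rTensor K V g) :=
  LinearMap.rTensor_surjective V (g := g.restrictScalars K) hg

variable (V) in
theorem rTensor_exact_algebra (hfg : Function.Exact f g) (hg : Function.Surjective g) :
    Function.Exact (AlgebraTensorModule.rTensor K V f) (AlgebraTensorModule.rTensor K V g) :=
  rTensor_exact (f := f.restrictScalars K) (g := g.restrictScalars K) V hfg hg

end

variable {K : Type u} [CommRing K] {A : Type (max u v)} [Ring A] [Algebra K A]
variable {N : Type (max u v)} [AddCommGroup N] [Module K N] [Module A N] [IsScalarTower K A N]

/-- If tensoring with projective `K`-modules yields modules of projective dimension at most `c`,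
then tensoring with `V` raises this by at most the projective dimension of `V`. -/
theorem hasProjectiveDimensionLT_tensor [Module.Flat K N] {c : ℕ}
    (hN : ∀ (V : Type (max u v w)) [AddCommGroup V] [Module K V] [Module.Projective K V],
      HasProjectiveDimensionLT (ModuleCat.of A (N ⊗[K] V)) (c + 1)) (g : ℕ)
    (V : Type (max u v w)) [AddCommGroup V] [Module K V]
    (hV : HasProjectiveDimensionLT (ModuleCat.of K V) (g + 1)) :
    HasProjectiveDimensionLT (ModuleCat.of A (N ⊗[K] V)) (c + 1 + g) := by
  induction g generalizing V with
  | zero =>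
    have := hasProjectiveDimensionLT_one_iff.1 hV
    exact hN V
  | succ g ih =>
    let p : (V →₀ K) →ₗ[K] V := Finsupp.linearCombination K id
    have hp : Function.Surjective p := fun v => ⟨Finsupp.single v 1, by simp [p]⟩
    have hex : Function.Exact (LinearMap.ker p).subtype p := fun x => by simp
    have h₁ : HasProjectiveDimensionLT (ModuleCat.of K (LinearMap.ker p)) (g + 1) :=
      hasProjectiveDimensionLT_left (Submodule.injective_subtype _) hex hp
        (hasProjectiveDimensionLT_of_projective (by omega)) hV
    have h₂ := hN (V →₀ K)
    have hinj : Function.Injective (AlgebraTensorModule.lTensor A N (LinearMap.ker p).subtype) :=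
      Module.Flat.lTensor_preserves_injective_linearMap (M := N) (LinearMap.ker p).subtype
        (Submodule.injective_subtype _)
    have hex' : Function.Exact (AlgebraTensorModule.lTensor A N (LinearMap.ker p).subtype)
        (AlgebraTensorModule.lTensor A N p) := by
      rw [AlgebraTensorModule.coe_lTensor, AlgebraTensorModule.coe_lTensor]
      exact lTensor_exact (M := LinearMap.ker p) N hex hp
    have hsurj : Function.Surjective (AlgebraTensorModule.lTensor A N p) := by
      rw [AlgebraTensorModule.coe_lTensor]
      exact LinearMap.lTensor_surjective N hp
    exact hasProjectiveDimensionLT_right hinj hex' hsurj (n := c + 1 + g) (ih _ h₁)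
      (hasProjectiveDimensionLT_of_ge _ (c + 1) _ (by omega))

/-- Restriction of scalars along an algebra that is projective as a module does not increase the
projective dimension. -/
theorem hasProjectiveDimensionLT_restrictScalars [Module.Projective K A] (d : ℕ)
    (X : Type (max u v w)) [AddCommGroup X] [Module K X] [Module A X] [IsScalarTower K A X]
    (hX : HasProjectiveDimensionLT (ModuleCat.of A X) (d + 1)) :
    HasProjectiveDimensionLT (ModuleCat.of K X) (d + 1) := by
  have hfree (X : Type (max u v w)) : Module.Projective K (X →₀ A) := by
    classical exact Module.Projective.of_equiv (finsuppLEquivDirectSum K A X).symm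
  induction d generalizing X with
  | zero =>
    have := hasProjectiveDimensionLT_one_iff.1 hX
    obtain ⟨s, hs⟩ := Module.projective_def'.1 this
    have : Module.Projective K X :=
      Module.Projective.of_split (s.restrictScalars K)
        ((Finsupp.linearCombination A id : (X →₀ A) →ₗ[A] X).restrictScalars K)
        (LinearMap.ext fun x => LinearMap.congr_fun hs x)
    exact hasProjectiveDimensionLT_of_projective (by omega)
  | succ d ih =>
    let p : (X →₀ A) →ₗ[A] X := Finsupp.linearCombination A id
    have hp : Function.Surjective p := fun v => ⟨Finsupp.single v 1, by simp [p]⟩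
    have hex : Function.Exact (LinearMap.ker p).subtype p := fun x => by simp
    have h₁ : HasProjectiveDimensionLT (ModuleCat.of A (LinearMap.ker p)) (d + 1) :=
      hasProjectiveDimensionLT_left (Submodule.injective_subtype _) hex hp
        (hasProjectiveDimensionLT_of_projective (by omega)) hX
    exact hasProjectiveDimensionLT_right
      (f := (LinearMap.ker p).subtype.restrictScalars K)
      (g := p.restrictScalars K) (Submodule.injective_subtype _) hex hp (ih _ h₁)
      (hasProjectiveDimensionLT_of_projective (by omega))

end Tensor

section GlobalDimension

variable {R : Type u} [Ring R]

theorem leftGlobalDimension_le_iff {n : ℕ} :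
    leftGlobalDimension.{w} R ≤ n ↔
      ∀ X : ModuleCat.{max u w} R, HasProjectiveDimensionLT X (n + 1) := by
  rw [leftGlobalDimension, iSup_le_iff]
  exact forall_congr' fun X => projectiveDimension_le_iff X n

theorem leftGlobalDimension_lt_top_iff :
    leftGlobalDimension.{w} R < ⊤ ↔
      ∃ n : ℕ, ∀ X : ModuleCat.{max u w} R, HasProjectiveDimensionLT X (n + 1) := by
  refine Iff.trans ?_ (exists_congr fun n => leftGlobalDimension_le_iff)
  generalize leftGlobalDimension.{w} R = d
  constructor
  · intro h
    induction d with
    | bot => exact ⟨0, bot_le⟩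
    | coe d =>
      induction d with
      | top => simp at h
      | coe d => exact ⟨d, le_rfl⟩
  · rintro ⟨n, hn⟩
    exact hn.trans_lt (WithBot.coe_lt_coe.2 (ENat.natCast_lt_top n))

theorem leftGlobalDimension_of_subsingleton [Subsingleton R] : leftGlobalDimension.{w} R = ⊥ := by
  refine le_antisymm (iSup_le fun X => ?_) bot_le
  rw [le_bot_iff, projectiveDimension_eq_bot_iff, ModuleCat.isZero_iff_subsingleton]
  exact Module.subsingleton R X

end GlobalDimension

end HomologicalAlgebra

/-! ### Left ideals, two-sided ideals and idempotents in finite regular monoids -/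

section GreenRelations

variable {M : Type*} [Monoid M]

/-- The principal left ideal `M x`. -/
def leftIdealOf (x : M) : Set M := {y | ∃ m, y = m * x}

/-- The elements of `M x` that generate a smaller left ideal than `x`. -/
def strictlyBelow (x : M) : Set M := {y | y ∈ leftIdealOf x ∧ x ∉ leftIdealOf y}

/-- A subset of a monoid stable under left multiplication. -/
def IsLeftStable (S : Set M) : Prop := ∀ (m : M) {x : M}, x ∈ S → m * x ∈ S

theorem mem_leftIdealOf_self (x : M) : x ∈ leftIdealOf x := ⟨1, (one_mul x).symm⟩

theorem isLeftStable_leftIdealOf (x : M) : IsLeftStable (leftIdealOf x) := by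
  rintro m _ ⟨a, rfl⟩
  exact ⟨m * a, (mul_assoc _ _ _).symm⟩

theorem leftIdealOf_subset {S : Set M} (hS : IsLeftStable S) {x : M} (hx : x ∈ S) :
    leftIdealOf x ⊆ S := by
  rintro _ ⟨m, rfl⟩
  exact hS m hx

theorem isLeftStable_strictlyBelow (x : M) : IsLeftStable (strictlyBelow x) := fun m y hy =>
  ⟨isLeftStable_leftIdealOf x m hy.1,
    fun h => hy.2 (leftIdealOf_subset (isLeftStable_leftIdealOf y) ⟨m, rfl⟩ h)⟩

theorem strictlyBelow_subset (x : M) : strictlyBelow x ⊆ leftIdealOf x := fun _ h => h.1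

theorem mem_principalIdeal_self (x : M) : x ∈ principalIdeal x := ⟨1, 1, by simp⟩

theorem isMonoidIdeal_principalIdeal (x : M) : IsMonoidIdeal (principalIdeal x) where
  nonempty := ⟨x, mem_principalIdeal_self x⟩
  mul_mem_left := by
    rintro m _ ⟨a, b, rfl⟩
    exact ⟨m * a, b, by simp only [mul_assoc]⟩
  mul_mem_right := by
    rintro m _ ⟨a, b, rfl⟩
    exact ⟨a, b * m, by simp only [mul_assoc]⟩

theorem principalIdeal_subset {I : Set M} (hI : IsMonoidIdeal I) {x : M} (hx : x ∈ I) :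
    principalIdeal x ⊆ I := by
  rintro _ ⟨a, b, rfl⟩
  exact hI.mul_mem_right b (hI.mul_mem_left a hx)

theorem leftIdealOf_subset_principalIdeal (x : M) : leftIdealOf x ⊆ principalIdeal x := by
  rintro _ ⟨m, rfl⟩
  exact ⟨m, 1, (mul_one _).symm⟩

/-- Finite monoids are stable: within a left ideal `M f`, two-sided equivalence to `f` implies
left equivalence to `f`. -/
theorem mem_leftIdealOf_of_mem_principalIdeal [Finite M] {f y : M} (hy : y ∈ leftIdealOf f)
    (hf : f ∈ principalIdeal y) : f ∈ leftIdealOf y := by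
  obtain ⟨u, v, hf⟩ := hf
  -- From f = uyv one gets Mf ⊆ (My)v, hence |Mf| ≤ |My|; with My ⊆ Mf this forces equality.
  have hsub : leftIdealOf f ⊆ (· * v) '' leftIdealOf y := by
    rintro _ ⟨m, rfl⟩
    exact ⟨m * u * y, ⟨m * u, rfl⟩, by rw [hf]; simp only [mul_assoc]⟩
  have hcard : (leftIdealOf f).ncard ≤ (leftIdealOf y).ncard :=
    (Set.ncard_le_ncard hsub (Set.toFinite _)).trans (Set.ncard_image_le (Set.toFinite _))
  rw [Set.eq_of_subset_of_ncard_le (leftIdealOf_subset (isLeftStable_leftIdealOf f) hy) hcard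
    (Set.toFinite _)]
  exact mem_leftIdealOf_self f

theorem notMem_principalIdeal_of_mem_strictlyBelow [Finite M] {f y : M}
    (hy : y ∈ strictlyBelow f) : f ∉ principalIdeal y :=
  fun h => hy.2 (mem_leftIdealOf_of_mem_principalIdeal hy.1 h)

theorem IsRegularMonoid.exists_idempotent_leftIdealOf_eq (hM : IsRegularMonoid M) (x : M) :
    ∃ f : M, IsIdempotentElem f ∧ leftIdealOf f = leftIdealOf x := by
  obtain ⟨t, ht⟩ := hM x
  refine ⟨t * x, ?_, Set.Subset.antisymm ?_ ?_⟩
  · rw [IsIdempotentElem, mul_assoc, ← mul_assoc x, ht]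
  · exact leftIdealOf_subset (isLeftStable_leftIdealOf x) ⟨t, rfl⟩
  · exact leftIdealOf_subset (isLeftStable_leftIdealOf _) ⟨x, by rw [← mul_assoc, ht]⟩

theorem IsRegularMonoid.exists_idempotent_principalIdeal_eq (hM : IsRegularMonoid M) (x : M) :
    ∃ f : M, IsIdempotentElem f ∧ principalIdeal f = principalIdeal x := by
  obtain ⟨f, hf, h⟩ := hM.exists_idempotent_leftIdealOf_eq x
  refine ⟨f, hf, Set.Subset.antisymm ?_ ?_⟩
  · exact principalIdeal_subset (isMonoidIdeal_principalIdeal x)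
      (leftIdealOf_subset_principalIdeal x (h ▸ mem_leftIdealOf_self f))
  · exact principalIdeal_subset (isMonoidIdeal_principalIdeal f)
      (leftIdealOf_subset_principalIdeal f (h ▸ mem_leftIdealOf_self x))

theorem mul_idempotent_of_mem_leftIdealOf {f x : M} (hf : IsIdempotentElem f)
    (hx : x ∈ leftIdealOf f) : x * f = x := by
  obtain ⟨m, rfl⟩ := hx
  rw [mul_assoc, hf.eq]

end GreenRelations

/-! ### Contracted algebras and their left ideals spanned by monoid elements -/

/-- A presentation of a `K`-algebra `A` as a contracted algebra of a finite monoid `M`: the images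
of the elements of `M` outside a left stable subset `zeroSet` form a `K`-basis of `A`, with dual
basis `coef`, and the elements of `zeroSet` are mapped to zero. -/
structure ContractedBasis (K A M : Type*) [CommRing K] [Ring A] [Algebra K A] [Monoid M]
    [Fintype M] where
  /-- the multiplicative map from `M` to `A` -/
  toAlg : M →* A
  /-- the elements mapped to zero -/
  zeroSet : Set M
  /-- the coordinate functionals -/
  coef : M → A →ₗ[K] K
  zeroSet_stable : IsLeftStable zeroSet
  map_zeroSet : ∀ x ∈ zeroSet, toAlg x = 0
  coef_self : ∀ x ∉ zeroSet, coef x (toAlg x) = 1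
  coef_ne : ∀ x y, x ≠ y → coef x (toAlg y) = 0
  sum_coef : ∀ a, ∑ x, coef x a • toAlg x = a

namespace ContractedBasis

open TensorProduct

variable {K : Type u} {A : Type v} {M : Type*} [CommRing K] [Ring A] [Algebra K A] [Monoid M]
  [Fintype M] (b : ContractedBasis K A M)

theorem coef_eq_zero_of_mem {x : M} (hx : x ∈ b.zeroSet) (a : A) : b.coef x a = 0 := by
  rw [← b.sum_coef a, map_sum]
  refine Finset.sum_eq_zero fun y _ => ?_
  rw [map_smul]
  by_cases h : x = y
  · subst h
    rw [b.map_zeroSet x hx, map_zero, smul_zero]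
  · rw [b.coef_ne x y h, smul_zero]

/-- Induction over the `K`-span of the monoid elements. -/
theorem induction_on {p : A → Prop} (a : A) (h0 : p 0) (hadd : ∀ a a', p a → p a' → p (a + a'))
    (hsmul : ∀ (k : K) (x : M), p (k • b.toAlg x)) : p a := by
  rw [← b.sum_coef a]
  exact Finset.sum_induction _ p (fun a a' => hadd a a') h0 fun x _ => hsmul _ x

/-- The left ideal of `A` generated by a subset of `M`. -/
def sub (S : Set M) : Submodule A A := Submodule.span A (b.toAlg '' S)

theorem toAlg_mem_sub {S : Set M} {x : M} (hx : x ∈ S) : b.toAlg x ∈ b.sub S :=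
  Submodule.subset_span ⟨x, hx, rfl⟩

theorem sub_mono {S T : Set M} (h : S ⊆ T) : b.sub S ≤ b.sub T :=
  Submodule.span_mono (Set.image_mono h)

theorem mem_sub_of_coef {S : Set M} {a : A} (h : ∀ x ∉ S, b.coef x a = 0) : a ∈ b.sub S := by
  rw [← b.sum_coef a]
  refine Submodule.sum_mem _ fun x _ => ?_
  by_cases hx : x ∈ S
  · exact Submodule.smul_of_tower_mem _ _ (b.toAlg_mem_sub hx)
  · rw [h x hx, zero_smul]
    exact zero_mem _

theorem coef_mul_eq_zero {S : Set M} (hS : IsLeftStable S) {x y : M} (hx : x ∉ S) (hy : y ∈ S)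
    (c : A) : b.coef x (c * b.toAlg y) = 0 := by
  induction c using b.induction_on with
  | h0 => simp
  | hadd c c' h h' => rw [add_mul, map_add, h, h', add_zero]
  | hsmul k z =>
    rw [smul_mul_assoc, ← map_mul, map_smul,
      b.coef_ne x (z * y) fun h => hx (h ▸ hS z hy), smul_zero]

/-- Left stability is what keeps the left ideal generated by S inside the K-span of S, so that
membership can be read off from coordinates. -/
theorem coef_eq_zero {S : Set M} (hS : IsLeftStable S) {a : A} (ha : a ∈ b.sub S) {x : M}
    (hx : x ∉ S) : b.coef x a = 0 := by
  induction ha using Submodule.span_induction generalizing x with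
  | mem a ha =>
    obtain ⟨y, hy, rfl⟩ := ha
    exact b.coef_ne x y fun h => hx (h ▸ hy)
  | zero => exact map_zero _
  | add a a' _ _ h h' => rw [map_add, h hx, h' hx, add_zero]
  | smul c a _ h =>
    rw [← b.sum_coef a, smul_eq_mul, Finset.mul_sum, map_sum]
    refine Finset.sum_eq_zero fun y _ => ?_
    by_cases hy : y ∈ S
    · rw [mul_smul_comm, map_smul, b.coef_mul_eq_zero hS hx hy, smul_zero]
    · rw [h hy, zero_smul, mul_zero, map_zero]

theorem mem_sub_iff {S : Set M} (hS : IsLeftStable S) {a : A} :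
    a ∈ b.sub S ↔ ∀ x ∉ S, b.coef x a = 0 :=
  ⟨fun h _ hx => b.coef_eq_zero hS h hx, b.mem_sub_of_coef⟩

theorem sub_inf {S T : Set M} (hS : IsLeftStable S) (hT : IsLeftStable T) :
    b.sub S ⊓ b.sub T = b.sub (S ∩ T) := by
  have hST : IsLeftStable (S ∩ T) := fun m x hx => ⟨hS m hx.1, hT m hx.2⟩
  ext a
  rw [Submodule.mem_inf, b.mem_sub_iff hS, b.mem_sub_iff hT, b.mem_sub_iff hST]
  refine ⟨fun h x hx => ?_, fun h => ⟨fun x hx => h x fun h' => hx h'.1,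
    fun x hx => h x fun h' => hx h'.2⟩⟩
  by_cases hxS : x ∈ S
  · exact h.2 x fun hxT => hx ⟨hxS, hxT⟩
  · exact h.1 x hxS

theorem sub_sup (S T : Set M) : b.sub S ⊔ b.sub T = b.sub (S ∪ T) := by
  rw [sub, sub, sub, Set.image_union, Submodule.span_union]

open Classical in
/-- The `K`-linear projection of `A` onto the span of a subset of `M`. -/
noncomputable def proj (S : Set M) : A →ₗ[K] A :=
  ∑ x with x ∈ S, (b.coef x).smulRight (b.toAlg x)

theorem coef_proj_of_notMem {S : Set M} {x : M} (hx : x ∉ S) (a : A) :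
    b.coef x (b.proj S a) = 0 := by
  classical
  simp only [proj, LinearMap.sum_apply, LinearMap.smulRight_apply, map_sum, map_smul]
  refine Finset.sum_eq_zero fun y hy => ?_
  rw [b.coef_ne x y, smul_zero]
  rintro rfl
  exact hx (by simpa using hy)

theorem coef_proj_of_mem {S : Set M} {x : M} (hx : x ∈ S) (a : A) :
    b.coef x (b.proj S a) = b.coef x a := by
  classical
  by_cases hz : x ∈ b.zeroSet
  · simp [b.coef_eq_zero_of_mem hz]
  · simp only [proj, LinearMap.sum_apply, LinearMap.smulRight_apply, map_sum, map_smul]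
    rw [Finset.sum_eq_single_of_mem x (by simpa using hx)]
    · rw [b.coef_self x hz, smul_eq_mul, mul_one]
    · intro y _ hy
      rw [b.coef_ne x y hy.symm, smul_zero]

theorem proj_mem_sub (S : Set M) (a : A) : b.proj S a ∈ b.sub S :=
  b.mem_sub_of_coef fun _ hx => b.coef_proj_of_notMem hx a

theorem ext_coef {a a' : A} (h : ∀ x, b.coef x a = b.coef x a') : a = a' := by
  rw [← b.sum_coef a, ← b.sum_coef a']
  exact Finset.sum_congr rfl fun x _ => by rw [h]

theorem proj_of_mem {S : Set M} (hS : IsLeftStable S) {a : A} (ha : a ∈ b.sub S) :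
    b.proj S a = a := by
  refine b.ext_coef fun x => ?_
  by_cases hx : x ∈ S
  · exact b.coef_proj_of_mem hx a
  · rw [b.coef_proj_of_notMem hx, b.coef_eq_zero hS ha hx]

include b in
theorem projective : Module.Projective K A := by
  refine Module.Projective.of_split (M := M → K) (LinearMap.pi b.coef)
    (∑ x, (LinearMap.proj x).smulRight (b.toAlg x)) (LinearMap.ext fun a => ?_)
  simpa using b.sum_coef a

/-- The subquotient of `A` attached to two left stable subsets `S ⊆ T` of `M`. -/
abbrev subquot (S T : Set M) : Type v := b.sub T ⧸ (b.sub S).comap (b.sub T).subtype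

/-- The class in a subquotient of an element of `A`. -/
noncomputable def toSubquot (S T : Set M) : A →ₗ[K] b.subquot S T :=
  ((Submodule.mkQ ((b.sub S).comap (b.sub T).subtype)).restrictScalars K) ∘ₗ
    LinearMap.codRestrict ((b.sub T).restrictScalars K) (b.proj T) (b.proj_mem_sub T)

/-- `toSubquot` is made total on A by projecting first; on `sub T` that projection is the identity.
-/
theorem mk_eq_toSubquot {S T : Set M} (hT : IsLeftStable T) (a : b.sub T) :
    (Submodule.Quotient.mk a : b.subquot S T) = b.toSubquot S T a := by
  have : a = ⟨b.proj T a, b.proj_mem_sub T a⟩ := Subtype.ext (b.proj_of_mem hT a.2).symm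
  conv_lhs => rw [this]
  rfl

theorem smul_toSubquot {S T : Set M} (hT : IsLeftStable T) (c : A) {a : A} (ha : a ∈ b.sub T) :
    c • b.toSubquot S T a = b.toSubquot S T (c * a) := by
  rw [← b.mk_eq_toSubquot hT ⟨a, ha⟩, ← b.mk_eq_toSubquot hT ⟨c * a, Submodule.smul_mem _ c ha⟩]
  rfl

theorem toSubquot_eq_zero {S T : Set M} (hT : IsLeftStable T) (hST : S ⊆ T) {a : A}
    (ha : a ∈ b.sub S) : b.toSubquot S T a = 0 := by
  rw [← b.mk_eq_toSubquot hT ⟨a, b.sub_mono hST ha⟩, Submodule.Quotient.mk_eq_zero]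
  exact ha

/-- A subquotient is spanned over `K` by the classes of the monoid elements in it. -/
theorem subquot_induction {S T : Set M} (hT : IsLeftStable T) (hST : S ⊆ T)
    {p : b.subquot S T → Prop} (x : b.subquot S T) (h0 : p 0)
    (hadd : ∀ x y, p x → p y → p (x + y))
    (hsmul : ∀ (k : K), ∀ y ∈ T, y ∉ S → y ∉ b.zeroSet → p (k • b.toSubquot S T (b.toAlg y))) :
    p x := by
  obtain ⟨a, rfl⟩ := Submodule.Quotient.mk_surjective _ x
  rw [b.mk_eq_toSubquot hT, ← b.sum_coef a, map_sum]
  refine Finset.sum_induction _ p hadd h0 fun y _ => ?_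
  rw [map_smul]
  by_cases hyT : y ∈ T
  · by_cases hyS : y ∈ S
    · rwa [b.toSubquot_eq_zero hT hST (b.toAlg_mem_sub hyS), smul_zero]
    · by_cases hyz : y ∈ b.zeroSet
      · rwa [b.map_zeroSet y hyz, map_zero, smul_zero]
      · exact hsmul _ y hyT hyS hyz
  · rwa [b.coef_eq_zero hT a.2 hyT, zero_smul]

/-- The map out of a subquotient induced by a `K`-linear map on `A`. -/
noncomputable def subquotLift {S T : Set M} {W : Type*} [AddCommGroup W] [Module K W]
    (φ : A →ₗ[K] W) (hφ : ∀ a ∈ b.sub S, φ a = 0) : b.subquot S T →ₗ[K] W :=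
  Submodule.liftQ (((b.sub S).comap (b.sub T).subtype).restrictScalars K)
    (φ ∘ₗ ((b.sub T).subtype.restrictScalars K)) (fun a ha => hφ a ha)

theorem subquotLift_toSubquot {S T : Set M} {W : Type*} [AddCommGroup W] [Module K W]
    (φ : A →ₗ[K] W) (hφ : ∀ a ∈ b.sub S, φ a = 0) (hT : IsLeftStable T) {a : A}
    (ha : a ∈ b.sub T) :
    b.subquotLift (T := T) φ hφ (b.toSubquot S T a) = φ a := by
  rw [← b.mk_eq_toSubquot hT ⟨a, ha⟩]
  rfl

/-- Representatives supported off S split `toSubquot` over K, so the subquotient is a K-summand of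
A. -/
theorem projective_subquot {S T : Set M} (hS : IsLeftStable S) (hT : IsLeftStable T)
    (hST : S ⊆ T) : Module.Projective K (b.subquot S T) := by
  have := b.projective
  refine Module.Projective.of_split
    (b.subquotLift (b.proj Sᶜ) fun a ha => b.ext_coef fun x => ?_) (b.toSubquot S T)
    (LinearMap.ext fun x => ?_)
  · rw [map_zero]
    by_cases hx : x ∈ S
    · exact b.coef_proj_of_notMem (Set.notMem_compl_iff.2 hx) a
    · rw [b.coef_proj_of_mem (Set.mem_compl hx), b.coef_eq_zero hS ha hx]
  · induction x using b.subquot_induction hT hST with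
    | h0 => simp
    | hadd x y hx hy => rw [map_add, hx, hy, map_add]
    | hsmul k y hyT hyS =>
      have hy := b.toAlg_mem_sub hyT
      rw [LinearMap.comp_apply, map_smul, map_smul, b.subquotLift_toSubquot _ _ hT hy,
        LinearMap.id_apply]
      congr 2
      refine b.ext_coef fun x => ?_
      by_cases hx : x ∈ S
      · rw [b.coef_proj_of_notMem (Set.notMem_compl_iff.2 hx), b.coef_ne x y fun h => hyS (h ▸ hx)]
      · exact b.coef_proj_of_mem (Set.mem_compl hx) _

theorem exists_retraction_inclusion {S T : Set M} (hS : IsLeftStable S) (hST : S ⊆ T) :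
    ∃ s : b.sub T →ₗ[K] b.sub S, ∀ x, s (Submodule.inclusion (b.sub_mono hST) x) = x :=
  ⟨LinearMap.codRestrict ((b.sub S).restrictScalars K) (b.proj S) (b.proj_mem_sub S) ∘ₗ
    ((b.sub T).subtype.restrictScalars K), fun x => Subtype.ext (b.proj_of_mem hS x.2)⟩

section

variable (V : Type*) [AddCommGroup V] [Module K V] {S T : Set M}

theorem sub_tensor_injective (hS : IsLeftStable S) (hST : S ⊆ T) :
    Function.Injective
      (AlgebraTensorModule.rTensor K V (Submodule.inclusion (b.sub_mono hST))) := by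
  obtain ⟨s, hs⟩ := b.exists_retraction_inclusion hS hST
  exact rTensor_injective_of_retraction V s hs

theorem sub_tensor_exact (hST : S ⊆ T) :
    Function.Exact (AlgebraTensorModule.rTensor K V (Submodule.inclusion (b.sub_mono hST)))
      (AlgebraTensorModule.rTensor K V
        (Submodule.mkQ ((b.sub S).comap (b.sub T).subtype))) := by
  refine rTensor_exact_algebra V (fun x => ?_) (Submodule.mkQ_surjective _)
  rw [Submodule.mkQ_apply, Submodule.Quotient.mk_eq_zero]
  exact ⟨fun h => ⟨⟨x, h⟩, rfl⟩, by rintro ⟨y, rfl⟩; exact y.2⟩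

theorem sub_tensor_surjective :
    Function.Surjective (AlgebraTensorModule.rTensor K V
        (Submodule.mkQ ((b.sub S).comap (b.sub T).subtype))) :=
  rTensor_surjective_algebra V (Submodule.mkQ_surjective _)

end

/-- Right multiplication by f is an A-linear retraction of A onto Af. -/
theorem projective_sub_leftIdealOf {f : M} (hf : IsIdempotentElem f) :
    Module.Projective A (b.sub (leftIdealOf f)) := by
  refine Module.Projective.of_split (b.sub (leftIdealOf f)).subtype
    (LinearMap.codRestrict _ (LinearMap.toSpanSingleton A A (b.toAlg f)) fun a =>
      Submodule.smul_mem _ a (b.toAlg_mem_sub (mem_leftIdealOf_self f)))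
    (LinearMap.ext fun ⟨a, ha⟩ => Subtype.ext ?_)
  change a * b.toAlg f = a
  induction ha using Submodule.span_induction with
  | mem a ha =>
    obtain ⟨y, hy, rfl⟩ := ha
    rw [← map_mul, mul_idempotent_of_mem_leftIdealOf hf hy]
  | zero => exact zero_mul _
  | add a a' _ _ h h' => rw [add_mul, h, h']
  | smul c a _ h => rw [smul_eq_mul, mul_assoc, h]

/-- The standard module attached to the left ideal `M f`: the quotient of `A f` by the span of the
elements that generate smaller left ideals. -/
abbrev standard (f : M) : Type v := b.subquot (strictlyBelow f) (leftIdealOf f)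

instance flat_standard (f : M) : Module.Flat K (b.standard f) :=
  have := b.projective_subquot (isLeftStable_strictlyBelow f) (isLeftStable_leftIdealOf f)
    (strictlyBelow_subset f)
  inferInstance

/-- A property of `A`-modules that is stable under extensions and holds for zero modules passes from
the standard modules to all left ideals spanned by subsets of `M`. -/
theorem filtration_induction (hM : IsRegularMonoid M) {V : Type t} [AddCommGroup V] [Module K V]
    (Φ : ModuleCat.{max v t} A → Prop)
    (h0 : ∀ (X : Type (max v t)) [AddCommGroup X] [Module A X] [Subsingleton X],
      Φ (ModuleCat.of A X))
    (hext : ∀ (X₁ X₂ X₃ : Type (max v t)) [AddCommGroup X₁] [AddCommGroup X₂] [AddCommGroup X₃]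
      [Module A X₁] [Module A X₂] [Module A X₃] (f : X₁ →ₗ[A] X₂) (g : X₂ →ₗ[A] X₃),
      Function.Injective f → Function.Exact f g → Function.Surjective g →
      Φ (ModuleCat.of A X₁) → Φ (ModuleCat.of A X₃) → Φ (ModuleCat.of A X₂))
    {T : Set M} (hT : IsLeftStable T)
    (hΦ : ∀ f ∈ T, f ∉ b.zeroSet → IsIdempotentElem f →
      Φ (ModuleCat.of A (b.standard f ⊗[K] V))) :
    Φ (ModuleCat.of A (b.sub T ⊗[K] V)) := by
  induction hn : T.ncard using Nat.strong_induction_on generalizing T with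
  | _ n ih =>
  by_cases hne : (T \ b.zeroSet).Nonempty
  -- Remove from T the left class of an f with |Mf| maximal. Maximality makes the remainder T' left
  -- stable, and the layer removed is Δ_f.
  · obtain ⟨x, hx, hmax⟩ := (T \ b.zeroSet).exists_max_image
      (fun x => (leftIdealOf x).ncard) (Set.toFinite _) hne
    obtain ⟨f, hf, hfx⟩ := hM.exists_idempotent_leftIdealOf_eq x
    have hxf : x ∈ leftIdealOf f := hfx ▸ mem_leftIdealOf_self x
    have hfT : f ∈ T := leftIdealOf_subset hT hx.1 (hfx ▸ mem_leftIdealOf_self f)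
    have hfZ : f ∉ b.zeroSet := fun h => hx.2 (leftIdealOf_subset b.zeroSet_stable h hxf)
    let T' : Set M := {y ∈ T | f ∈ leftIdealOf y → y ∉ leftIdealOf f}
    have hT'T : T' ⊆ T := fun y hy => hy.1
    have hT' : IsLeftStable T' := by
      refine fun m y hy => ⟨hT m hy.1, fun h h' => ?_⟩
      have hfy : f ∈ leftIdealOf y :=
        leftIdealOf_subset (isLeftStable_leftIdealOf y) ⟨m, rfl⟩ h
      have hyZ : y ∉ b.zeroSet := fun hy' => hfZ (leftIdealOf_subset b.zeroSet_stable hy' hfy)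
      refine hy.2 hfy ?_
      have := hmax y ⟨hy.1, hyZ⟩
      rw [← hfx] at this
      rw [Set.eq_of_subset_of_ncard_le
        (leftIdealOf_subset (isLeftStable_leftIdealOf y) hfy) this (Set.toFinite _)]
      exact mem_leftIdealOf_self y
    have hlt : T'.ncard < n := by
      rw [← hn]
      refine Set.ncard_lt_ncard ⟨hT'T, fun h => ?_⟩ (Set.toFinite _)
      exact (h hfT).2 (mem_leftIdealOf_self f) (mem_leftIdealOf_self f)
    have h₁ := ih _ hlt hT' (fun g hg => hΦ g (hT'T hg)) rfl
    have hinf : b.sub (leftIdealOf f) ⊓ b.sub T' = b.sub (strictlyBelow f) := by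
      rw [b.sub_inf (isLeftStable_leftIdealOf f) hT']
      congr 1
      ext y
      exact ⟨fun h => ⟨h.1, fun h' => h.2.2 h' h.1⟩,
        fun h => ⟨h.1, leftIdealOf_subset hT hfT h.1, fun h' => (h.2 h').elim⟩⟩
    have hsup : b.sub (leftIdealOf f) ⊔ b.sub T' = b.sub T := by
      rw [b.sub_sup]
      congr 1
      refine Set.Subset.antisymm (Set.union_subset (leftIdealOf_subset hT hfT) hT'T)
        fun y hy => ?_
      by_cases h : y ∈ leftIdealOf f
      · exact Or.inl h
      · exact Or.inr ⟨hy, fun _ => h⟩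
    -- Second isomorphism theorem: Δ_f = sub(Mf) / (sub(Mf) ∩ sub T') ≅ sub T / sub T'.
    have e := LinearMap.quotientInfEquivSupQuotient (b.sub (leftIdealOf f)) (b.sub T')
    rw [← Submodule.comap_inf, hinf, hsup] at e
    have h₃ : Φ (ModuleCat.of A (b.subquot T' T ⊗[K] V)) := by
      -- Isomorphism invariance of Φ is the case of an extension by the zero module.
      refine hext _ _ PUnit (AlgebraTensorModule.congr e (LinearEquiv.refl K V)).toLinearMap 0
        (LinearEquiv.injective _) (fun y => ?_) (fun y => ⟨0, Subsingleton.elim _ _⟩)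
        (hΦ f hfT hfZ hf) (h0 _)
      simp
    exact hext _ _ _ _ _ (b.sub_tensor_injective V hT' hT'T) (b.sub_tensor_exact V hT'T)
      (b.sub_tensor_surjective V) h₁ h₃
  · have hsub : b.sub T = ⊥ := by
      rw [sub, Submodule.span_eq_bot]
      rintro _ ⟨x, hx, rfl⟩
      exact b.map_zeroSet x (by_contra fun h => hne ⟨x, hx, h⟩)
    rw [hsub]
    exact h0 _

end ContractedBasis

/-! ### Maximal subgroups -/

namespace MaximalSubgroup

variable {M : Type*} [Monoid M] {e : M} {he : IsIdempotentElem e}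

/-- The underlying monoid element of an element of a maximal subgroup. -/
def val (g : MaximalSubgroup he) : M := g.1.1

theorem val_injective : Function.Injective (val : MaximalSubgroup he → M) :=
  fun _ _ h => Units.ext (Subtype.ext h)

theorem val_mul (g h : MaximalSubgroup he) : (g * h).val = g.val * h.val := rfl

theorem val_one : (1 : MaximalSubgroup he).val = e := rfl

theorem idem_mul_val (g : MaximalSubgroup he) : e * g.val = g.val :=
  congrArg val (one_mul g)

theorem val_mul_idem (g : MaximalSubgroup he) : g.val * e = g.val :=
  congrArg val (mul_one g)

theorem val_mul_val_inv (g : MaximalSubgroup he) : g.val * (g⁻¹).val = e := by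
  rw [← val_mul, mul_inv_cancel, val_one]

/-- In the finite monoid eMe a left inverse is two-sided. -/
theorem exists_val_eq [Finite M] {l : M} (hel : e * l = l) (hl : l ∈ leftIdealOf e)
    (hl' : e ∈ leftIdealOf l) : ∃ g : MaximalSubgroup he, g.val = l := by
  have hle := mul_idempotent_of_mem_leftIdealOf he hl
  obtain ⟨m, hm⟩ := hl'
  have : Finite (LocalMonoid he) := inferInstanceAs (Finite (Subsemigroup.corner e))
  let x : LocalMonoid he := ⟨l, l, by simp only [hel, hle]⟩
  let y : LocalMonoid he := ⟨e * m * e, m, rfl⟩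
  have hyx : y * x = 1 := Subtype.ext (by
    change e * m * e * l = e
    rw [mul_assoc, hel, mul_assoc, ← hm, he.eq])
  exact ⟨⟨x, y, mul_eq_one_symm hyx, hyx⟩, rfl⟩

instance [Finite M] : Finite (MaximalSubgroup he) := Finite.of_injective _ val_injective

theorem mul_val_mem_leftIdealOf (g : MaximalSubgroup he) (y : M) : y * g.val ∈ leftIdealOf e :=
  ⟨y * g.val, by rw [mul_assoc, g.val_mul_idem]⟩

/-- Stability prevents right multiplication from climbing back to the left class of e; hence G_e
acts on Δ_e from the right. -/
theorem mul_val_mem_strictlyBelow [Finite M] (g : MaximalSubgroup he) {y : M} (hy : y ∈ strictlyBelow e) :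
    y * g.val ∈ strictlyBelow e := by
  refine ⟨mul_val_mem_leftIdealOf g y, fun h => ?_⟩
  obtain ⟨m, hm⟩ := h
  exact notMem_principalIdeal_of_mem_strictlyBelow hy ⟨m, g.val, by rw [mul_assoc, ← hm]⟩

end MaximalSubgroup

/-! ### The right group action on standard modules, and averaging -/

namespace ContractedBasis

open TensorProduct CategoryTheory

section RightMultiplication

variable {K A M : Type*} [CommRing K] [Ring A] [Algebra K A] [Monoid M]
  [Fintype M] (b : ContractedBasis K A M)

theorem mul_toAlg_mem_sub {S : Set M} {m : M} (hS : ∀ y ∈ S, y * m ∈ S) {a : A}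
    (ha : a ∈ b.sub S) : a * b.toAlg m ∈ b.sub S := by
  induction ha using Submodule.span_induction with
  | mem a ha =>
    obtain ⟨y, hy, rfl⟩ := ha
    rw [← map_mul]
    exact b.toAlg_mem_sub (hS y hy)
  | zero => rw [zero_mul]; exact zero_mem _
  | add a a' _ _ h h' => rw [add_mul]; exact add_mem h h'
  | smul c a _ h => rw [smul_eq_mul, mul_assoc]; exact Submodule.smul_mem _ c h

theorem smul_eq_zero_of_mem_sub {X : Type*} [AddCommGroup X] [Module A X] {S : Set M} {x : X}
    (hx : ∀ y ∈ S, b.toAlg y • x = 0) {a : A}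
    (ha : a ∈ b.sub S) : a • x = 0 := by
  induction ha using Submodule.span_induction with
  | mem a ha =>
    obtain ⟨y, hy, rfl⟩ := ha
    exact hx y hy
  | zero => exact zero_smul _ _
  | add a a' _ _ h h' => rw [add_smul, h, h', add_zero]
  | smul c a _ h => rw [smul_assoc, h, smul_zero]

/-- Right multiplication by a monoid element on a subquotient of `A`. -/
noncomputable def rightMul {S T : Set M} (m : M) (hS : ∀ y ∈ S, y * m ∈ S)
    (hT : ∀ y ∈ T, y * m ∈ T) : b.subquot S T →ₗ[A] b.subquot S T :=
  Submodule.mapQ _ _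
    (LinearMap.restrict (LinearMap.toSpanSingleton A A (b.toAlg m))
      fun _ ha => b.mul_toAlg_mem_sub hT ha)
    fun _ ha => b.mul_toAlg_mem_sub hS ha

theorem rightMul_toSubquot {S T : Set M} {m : M} (hS : ∀ y ∈ S, y * m ∈ S)
    (hT : ∀ y ∈ T, y * m ∈ T) (hT' : IsLeftStable T) {y : M} (hy : y ∈ T) :
    b.rightMul m hS hT (b.toSubquot S T (b.toAlg y)) = b.toSubquot S T (b.toAlg (y * m)) := by
  rw [← b.mk_eq_toSubquot hT' ⟨_, b.toAlg_mem_sub hy⟩,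
    ← b.mk_eq_toSubquot hT' ⟨_, b.toAlg_mem_sub (hT y hy)⟩]
  refine congrArg Submodule.Quotient.mk (Subtype.ext ?_)
  exact (map_mul b.toAlg y m).symm

variable {e : M} {he : IsIdempotentElem e}

/-- The class of a monoid element in a standard module. -/
noncomputable abbrev stdMk (e y : M) : b.standard e :=
  b.toSubquot (strictlyBelow e) (leftIdealOf e) (b.toAlg y)

/-- The right action of the maximal subgroup at `e` on the standard module at `e`. -/
noncomputable def groupMul (g : MaximalSubgroup he) : b.standard e →ₗ[A] b.standard e :=
  b.rightMul g.val (fun _ hy => g.mul_val_mem_strictlyBelow hy)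
    fun y _ => g.mul_val_mem_leftIdealOf y

theorem groupMul_stdMk (g : MaximalSubgroup he) {y : M} (hy : y ∈ leftIdealOf e) :
    b.groupMul g (b.stdMk e y) = b.stdMk e (y * g.val) :=
  b.rightMul_toSubquot _ _ (isLeftStable_leftIdealOf e) hy

theorem smul_stdMk (m : M) {y : M} (hy : y ∈ leftIdealOf e) :
    b.toAlg m • b.stdMk e y = b.stdMk e (m * y) := by
  rw [b.smul_toSubquot (isLeftStable_leftIdealOf e) _ (b.toAlg_mem_sub hy), stdMk, map_mul b.toAlg]

theorem stdMk_eq_zero {y : M} (hy : y ∈ strictlyBelow e) : b.stdMk e y = 0 :=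
  b.toSubquot_eq_zero (isLeftStable_leftIdealOf e) (strictlyBelow_subset e) (b.toAlg_mem_sub hy)

theorem std_induction {p : b.standard e → Prop} (x : b.standard e) (h0 : p 0)
    (hadd : ∀ x y, p x → p y → p (x + y))
    (hsmul : ∀ (k : K), ∀ y ∈ leftIdealOf e, e ∈ leftIdealOf y → p (k • b.stdMk e y)) : p x :=
  b.subquot_induction (isLeftStable_leftIdealOf e) (strictlyBelow_subset e) x h0 hadd
    fun k y hy hy' _ => hsmul k y hy (by_contra fun h => hy' ⟨hy, h⟩)

theorem std_tensor_induction {V : Type*} [AddCommGroup V] [Module K V]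
    {p : b.standard e ⊗[K] V → Prop} (x : b.standard e ⊗[K] V) (h0 : p 0)
    (hadd : ∀ x y, p x → p y → p (x + y))
    (hmk : ∀ y ∈ leftIdealOf e, e ∈ leftIdealOf y → ∀ v, p (b.stdMk e y ⊗ₜ v)) : p x := by
  induction x using TensorProduct.induction_on with
  | zero => exact h0
  | add x y hx hy => exact hadd x y hx hy
  | tmul x v =>
    induction x using b.std_induction with
    | h0 => rwa [zero_tmul]
    | hadd x y hx hy => rw [add_tmul]; exact hadd _ _ hx hy
    | hsmul k y hy hy' => rw [smul_tmul]; exact hmk y hy hy' _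

/-- The standard module at `e` is annihilated by the elements whose two-sided ideal does not
contain `e`. -/
theorem smul_std_tensor_eq_zero {V : Type*} [AddCommGroup V] [Module K V] {m : M}
    (hm : e ∉ principalIdeal m) (x : b.standard e ⊗[K] V) : b.toAlg m • x = 0 := by
  induction x using b.std_tensor_induction with
  | h0 => exact smul_zero _
  | hadd x y hx hy => rw [smul_add, hx, hy, add_zero]
  | hmk y hy hy' v =>
    rw [smul_tmul', b.smul_stdMk m hy, b.stdMk_eq_zero, zero_tmul]
    refine ⟨isLeftStable_leftIdealOf e m hy, ?_⟩
    rintro ⟨a, ha⟩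
    exact hm ⟨a, y, by rw [ha, mul_assoc]⟩

end RightMultiplication

section Averaging

variable {K A M : Type*} [CommRing K] [Ring A] [Algebra K A] [Monoid M]
  [Fintype M] (b : ContractedBasis K A M) {e : M} {he : IsIdempotentElem e}
  {X : Type*} [AddCommGroup X] [Module K X] [Module A X] [IsScalarTower K A X]

/-- The action map from the standard module at `e`, tensored with `X`, to a module `X` annihilated
by the elements strictly below `e`. -/
noncomputable def actMap (hX : ∀ y ∈ strictlyBelow e, ∀ x : X, b.toAlg y • x = 0) :
    b.standard e ⊗[K] X →ₗ[A] X :=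
  AlgebraTensorModule.lift (Submodule.liftQ _
    ((LinearMap.toSpanSingleton A (X →ₗ[K] X) LinearMap.id) ∘ₗ (b.sub (leftIdealOf e)).subtype) (by
      rintro ⟨a, _⟩ ha
      rw [LinearMap.mem_ker]
      ext x
      exact b.smul_eq_zero_of_mem_sub (fun y hy => hX y hy x) ha))

theorem actMap_tmul (hX : ∀ y ∈ strictlyBelow e, ∀ x : X, b.toAlg y • x = 0) {y : M}
    (hy : y ∈ leftIdealOf e) (x : X) : b.actMap hX (b.stdMk e y ⊗ₜ x) = b.toAlg y • x := by
  rw [stdMk, ← b.mk_eq_toSubquot (isLeftStable_leftIdealOf e) ⟨_, b.toAlg_mem_sub hy⟩]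
  rfl

/-- Averaging over the maximal subgroup at `e`. -/
noncomputable def average [Fintype (MaximalSubgroup he)] (X : Type*) [AddCommGroup X] [Module K X]
    [Module A X] [IsScalarTower K A X] (c : K) :
    b.standard e ⊗[K] X →ₗ[A] b.standard e ⊗[K] X :=
  c • ∑ g : MaximalSubgroup he,
    AlgebraTensorModule.map (b.groupMul g) (Algebra.lsmul K K X (b.toAlg (g⁻¹).val))

variable [Fintype (MaximalSubgroup he)]

theorem average_tmul (c : K) {y : M} (hy : y ∈ leftIdealOf e) (x : X) :
    b.average (he := he) X c (b.stdMk e y ⊗ₜ x) = c • ∑ g : MaximalSubgroup he,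
      b.stdMk e (y * g.val) ⊗ₜ[K] (b.toAlg (g⁻¹).val • x) := by
  simp only [average, LinearMap.smul_apply, LinearMap.sum_apply, AlgebraTensorModule.map_tmul]
  congr 1
  exact Finset.sum_congr rfl fun g _ => by rw [b.groupMul_stdMk g hy]; rfl

/-- Reindexing by g ↦ hg: averaging identifies yh ⊗ x with y ⊗ hx, so its image models Δ_e ⊗ X
balanced over G_e. -/
theorem average_mul_val (c : K) {y : M} (hy : y ∈ leftIdealOf e) (h : MaximalSubgroup he) (x : X) :
    b.average (he := he) X c (b.stdMk e (y * h.val) ⊗ₜ x) =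
      b.average (he := he) X c (b.stdMk e y ⊗ₜ (b.toAlg h.val • x)) := by
  rw [b.average_tmul c (h.mul_val_mem_leftIdealOf y), b.average_tmul c hy]
  congr 1
  refine Fintype.sum_equiv (Equiv.mulLeft h) _ _ fun g => ?_
  rw [Equiv.coe_mulLeft, smul_smul, ← map_mul, ← MaximalSubgroup.val_mul, mul_assoc,
    ← MaximalSubgroup.val_mul]
  congr 4
  group

theorem average_average {c : K} (hc : c * Fintype.card (MaximalSubgroup he) = 1)
    (s : b.standard e ⊗[K] X) :
    b.average (he := he) X c (b.average (he := he) X c s) = b.average (he := he) X c s := by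
  induction s using b.std_tensor_induction with
  | h0 => simp
  | hadd s s' h h' => simp only [map_add, h, h']
  | hmk y hy hy' x =>
    have : ∀ g : MaximalSubgroup he, b.average (he := he) X c
        (b.stdMk e (y * g.val) ⊗ₜ[K] (b.toAlg (g⁻¹).val • x)) =
        b.average (he := he) X c (b.stdMk e y ⊗ₜ x) := fun g => by
      rw [b.average_mul_val c hy, smul_smul, ← map_mul, g.val_mul_val_inv]
      -- This is the case h = 1, whose underlying element is e; it is needed because e need not act
      -- as the identity on X.
      have h : b.average (he := he) X c (b.stdMk e (y * e) ⊗ₜ x) =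
          b.average (he := he) X c (b.stdMk e y ⊗ₜ (b.toAlg e • x)) := b.average_mul_val c hy 1 x
      rw [← h, mul_idempotent_of_mem_leftIdealOf he hy]
    conv_lhs => rw [b.average_tmul c hy]
    rw [LinearMap.map_smul_of_tower, map_sum, Finset.sum_congr rfl fun g _ => this g,
      Finset.sum_const, Finset.card_univ, ← Nat.cast_smul_eq_nsmul K, smul_smul, hc, one_smul]

theorem actMap_average {c : K} (hc : c * Fintype.card (MaximalSubgroup he) = 1)
    (hX : ∀ y ∈ strictlyBelow e, ∀ x : X, b.toAlg y • x = 0)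
    (s : b.standard e ⊗[K] X) :
    b.actMap hX (b.average (he := he) X c s) = b.actMap hX s := by
  induction s using b.std_tensor_induction with
  | h0 => simp
  | hadd s s' h h' => simp only [map_add, h, h']
  | hmk y hy hy' x =>
    have : ∀ g : MaximalSubgroup he, b.actMap hX
        (b.stdMk e (y * g.val) ⊗ₜ[K] (b.toAlg (g⁻¹).val • x)) = b.toAlg y • x := fun g => by
      rw [b.actMap_tmul hX (g.mul_val_mem_leftIdealOf y), smul_smul, ← map_mul, mul_assoc,
        g.val_mul_val_inv, mul_idempotent_of_mem_leftIdealOf he hy]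
    rw [b.average_tmul c hy, LinearMap.map_smul_of_tower, map_sum,
      Finset.sum_congr rfl fun g _ => this g, b.actMap_tmul hX hy,
      Finset.sum_const, Finset.card_univ, ← Nat.cast_smul_eq_nsmul K, smul_smul, hc, one_smul]

/-- For y ∈ Me, the element ey is either in G_e, and then moves across the balanced tensor, or
strictly below e, and then both sides vanish. So e times an averaged tensor is determined by its
image in X. -/
theorem average_smul (c : K) (hX : ∀ y ∈ strictlyBelow e, ∀ x : X, b.toAlg y • x = 0)
    (s : b.standard e ⊗[K] X) :
    b.average (he := he) X c (b.toAlg e • s) =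
      b.average (he := he) X c (b.stdMk e e ⊗ₜ b.actMap hX (b.toAlg e • s)) := by
  induction s using b.std_tensor_induction with
  | h0 => simp
  | hadd s s' h h' => simp only [smul_add, tmul_add, map_add, h, h']
  | hmk y hy hy' x =>
    have hey : e * y ∈ leftIdealOf e := isLeftStable_leftIdealOf e e hy
    rw [smul_tmul', b.smul_stdMk e hy, b.actMap_tmul hX hey]
    by_cases h : e ∈ leftIdealOf (e * y)
    · obtain ⟨g, hg⟩ := MaximalSubgroup.exists_val_eq (he := he)
        (by rw [← mul_assoc, he.eq]) hey h
      rw [← hg, ← b.average_mul_val c (mem_leftIdealOf_self e), g.idem_mul_val]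
    · rw [b.stdMk_eq_zero ⟨hey, h⟩, hX _ ⟨hey, h⟩, zero_tmul, tmul_zero]

end Averaging

end ContractedBasis

/-! ### Upper bound by induction on depth -/

namespace ContractedBasis

open TensorProduct CategoryTheory

variable {K : Type u} {A : Type (max u v)} {M : Type*} [CommRing K] [Ring A] [Algebra K A]
  [Monoid M] [Fintype M] (b : ContractedBasis K A M)

/-- A depth function on a finite monoid: it does not decrease when passing to smaller ideals and
separates principal ideals; the zero set consists of the elements of depth at least `n`. -/
structure IsDepth (d : M → ℕ) (n : ℕ) : Prop where
  anti : ∀ x y, y ∈ principalIdeal x → d x ≤ d y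
  inj : ∀ x y, d x = d y → principalIdeal x = principalIdeal y
  mem_zeroSet : ∀ x, x ∈ b.zeroSet ↔ n ≤ d x

variable {b} {d : M → ℕ} {n : ℕ}

theorem IsDepth.eq_of_principalIdeal_eq (hd : b.IsDepth d n) {x y : M}
    (h : principalIdeal x = principalIdeal y) : d x = d y :=
  le_antisymm (hd.anti x y (h ▸ mem_principalIdeal_self y))
    (hd.anti y x (h ▸ mem_principalIdeal_self x))

theorem IsDepth.lt_of_mem_strictlyBelow (hd : b.IsDepth d n) {f y : M}
    (hy : y ∈ strictlyBelow f) : d f < d y := by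
  refine lt_of_le_of_ne (hd.anti f y (leftIdealOf_subset_principalIdeal f hy.1)) fun h => ?_
  refine notMem_principalIdeal_of_mem_strictlyBelow hy ?_
  rw [← hd.inj f y h]
  exact mem_principalIdeal_self f

variable (hM : IsRegularMonoid M)
include hM

/-- Af ⊗ V is projective, and the kernel of its map onto Δ_f ⊗ V is filtered by standard modules of
greater depth, so the dimension is at most n - d f - 1. -/
theorem hasProjectiveDimensionLT_standard_of_projective (hd : b.IsDepth d n) (k : ℕ) {f : M}
    (hf : IsIdempotentElem f) (hk : n ≤ d f + (k + 1)) (V : Type (max u v w)) [AddCommGroup V]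
    [Module K V] [Module.Projective K V] :
    HasProjectiveDimensionLT (ModuleCat.of A (b.standard f ⊗[K] V)) (k + 1) := by
  induction k using Nat.strong_induction_on generalizing f with
  | _ k ih =>
  have := b.projective_sub_leftIdealOf hf
  refine hasProjectiveDimensionLT_right
    (b.sub_tensor_injective V (isLeftStable_strictlyBelow f) (strictlyBelow_subset f))
    (b.sub_tensor_exact V (strictlyBelow_subset f)) (b.sub_tensor_surjective V) ?_
    (hasProjectiveDimensionLT_of_projective (by omega))
  refine b.filtration_induction hM (fun X => HasProjectiveDimensionLT X k)
    (fun X _ _ _ => hasProjectiveDimensionLT_of_subsingleton k)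
    (fun X₁ X₂ X₃ _ _ _ _ _ _ f g hf hfg hg h₁ h₃ =>
      hasProjectiveDimensionLT_middle hf hfg hg h₁ h₃) (isLeftStable_strictlyBelow f) ?_
  intro y hy hyZ hy'
  have h₁ := hd.lt_of_mem_strictlyBelow hy
  rw [hd.mem_zeroSet] at hyZ
  exact hasProjectiveDimensionLT_mono (ih (n - d y - 1) (by omega) hy' (by omega)) (by omega)

theorem hasProjectiveDimensionLT_standard (hd : b.IsDepth d n) {f : M}
    (hf : IsIdempotentElem f) (hn : d f < n) {g : ℕ} (V : Type (max u v w)) [AddCommGroup V]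
    [Module K V] (hV : HasProjectiveDimensionLT (ModuleCat.of K V) (g + 1)) :
    HasProjectiveDimensionLT (ModuleCat.of A (b.standard f ⊗[K] V)) (n - d f + g) := by
  have := hasProjectiveDimensionLT_tensor (N := b.standard f) (A := A) (c := n - d f - 1)
    (fun V _ _ _ => hasProjectiveDimensionLT_standard_of_projective hM hd (n - d f - 1) hf
      (by omega) V) g V hV
  exact hasProjectiveDimensionLT_mono this (by omega)

omit hM in
/-- The inductive step for the upper bound: a module annihilated by all elements of depth greater
than `d e` is controlled by the standard module at `e` and modules annihilated by all elements of
depth at least `d e`. -/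
theorem hasProjectiveDimensionLT_of_killed (hd : b.IsDepth d n) {e : M} {he : IsIdempotentElem e}
    (hG : IsUnit (Nat.card (MaximalSubgroup he) : K)) (X : Type (max u v w)) [AddCommGroup X]
    [Module K X] [Module A X] [IsScalarTower K A X]
    (hX : ∀ y, d e + 1 ≤ d y → ∀ x : X, b.toAlg y • x = 0) {k k' : ℕ} (hk : k + 1 ≤ k')
    (hstd : HasProjectiveDimensionLT (ModuleCat.of A (b.standard e ⊗[K] X)) k')
    (ih : ∀ (Y : Type (max u v w)) [AddCommGroup Y] [Module K Y] [Module A Y] [IsScalarTower K A Y],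
      (∀ y, d e ≤ d y → ∀ x : Y, b.toAlg y • x = 0) →
      HasProjectiveDimensionLT (ModuleCat.of A Y) k) :
    HasProjectiveDimensionLT (ModuleCat.of A X) k' := by
  have := Fintype.ofFinite (MaximalSubgroup he)
  obtain ⟨c, hc⟩ := hG.exists_left_inv
  rw [Nat.card_eq_fintype_card] at hc
  have hX' : ∀ y ∈ strictlyBelow e, ∀ x : X, b.toAlg y • x = 0 := fun y hy =>
    hX y (hd.lt_of_mem_strictlyBelow hy)
  -- Depth separates principal ideals, so an element of depth exactly `d e` factors through e; only
  -- the action of e remains to be checked.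
  have hcases : ∀ {y}, d e ≤ d y → d e + 1 ≤ d y ∨ ∃ m m', y = m * e * m' := fun {y} hy => by
    rcases hy.lt_or_eq with h | h
    · exact Or.inl h
    · refine Or.inr ?_
      have := mem_principalIdeal_self y
      rwa [← hd.inj e y h] at this
  refine hasProjectiveDimensionLT_of_idempotent (b.actMap hX') (b.average (he := he) X c)
    (b.average_average hc) (b.actMap_average hc hX') hk hstd (ih _ fun y hy t => ?_)
    (ih _ fun y hy x => ?_)
  · rcases hcases hy with h | ⟨m, m', rfl⟩
    · refine Subtype.ext (b.smul_std_tensor_eq_zero (fun h' => ?_) _)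
      have := hd.anti y e h'
      omega
    · rw [map_mul, map_mul, mul_smul, mul_smul]
      refine (congrArg _ (Subtype.ext ?_)).trans (smul_zero _)
      -- For t = π s in the kernel of the action map α, α s = α t = 0, so `average_smul` gives e t =
      -- π(e ⊗ e α(s)) = 0.
      obtain ⟨⟨s, hs⟩, ht⟩ := (b.toAlg m' • t).2
      change b.toAlg e • (b.toAlg m' • t).1 = 0
      rw [← hs, ← map_smul, b.average_smul c hX', map_smul, ← b.actMap_average (he := he) hc, hs,
        LinearMap.mem_ker.1 ht, smul_zero, tmul_zero, map_zero]
  · obtain ⟨x, rfl⟩ := Submodule.Quotient.mk_surjective _ x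
    rw [← Submodule.Quotient.mk_smul, Submodule.Quotient.mk_eq_zero]
    rcases hcases hy with h | ⟨m, m', rfl⟩
    · rw [hX y h]
      exact zero_mem _
    · rw [map_mul, map_mul, mul_smul, mul_smul]
      -- The cokernel is killed because ex is the image of e ⊗ x.
      exact Submodule.smul_mem _ _ ⟨b.stdMk e e ⊗ₜ (b.toAlg m' • x),
        b.actMap_tmul hX' (mem_leftIdealOf_self e) _⟩

/-- Each level costs one dimension beyond the n + g of the start. At i = 0 even the identity of M
acts as zero, so X = 0; this is the exceptional value 0. -/
theorem hasProjectiveDimensionLT_of_depth (hd : b.IsDepth d n) (hn : 1 ≤ n)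
    (hG : ∀ x ∉ b.zeroSet, ∃ (e : M) (he : IsIdempotentElem e),
      principalIdeal e = principalIdeal x ∧ IsUnit (Nat.card (MaximalSubgroup he) : K))
    {g : ℕ} (hg : ∀ V : ModuleCat.{max u v w} K, HasProjectiveDimensionLT V (g + 1))
    (i : ℕ) (hi : i ≤ n) (X : Type (max u v w)) [AddCommGroup X]
    [Module K X] [Module A X] [IsScalarTower K A X]
    (hX : ∀ y, i ≤ d y → ∀ x : X, b.toAlg y • x = 0) :
    HasProjectiveDimensionLT (ModuleCat.of A X) (if i = 0 then 0 else n + g + i - 1) := by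
  induction i generalizing X with
  | zero =>
    have : Subsingleton X := subsingleton_of_forall_eq 0 fun x => by
      simpa using hX 1 (Nat.zero_le _) x
    exact hasProjectiveDimensionLT_of_subsingleton _
  | succ i ih =>
    rw [if_neg (Nat.succ_ne_zero i)]
    by_cases hy : ∃ y, d y = i
    · obtain ⟨y, rfl⟩ := hy
      obtain ⟨e, he, hey, hunit⟩ := hG y (by rw [hd.mem_zeroSet]; omega)
      rw [← hd.eq_of_principalIdeal_eq hey] at ih hX hi ⊢
      have hstd := hasProjectiveDimensionLT_standard hM hd he (by omega) X (hg (ModuleCat.of K X))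
      refine hasProjectiveDimensionLT_of_killed hd hunit X hX ?_
        (hasProjectiveDimensionLT_mono hstd ?_) fun Y _ _ _ _ hY => ih (by omega) Y hY
      · split_ifs <;> omega
      · omega
    -- No element has depth i: the level is skipped.
    · have := ih (by omega) X fun y hy' => hX y (by
        have : d y ≠ i := fun h => hy ⟨y, h⟩
        omega)
      refine hasProjectiveDimensionLT_mono this ?_
      split_ifs <;> omega

end ContractedBasis

theorem isUnit_natCast_of_prime_dvd {R : Type*} [CommSemiring R] {n : ℕ} (hn : n ≠ 0)
    (h : ∀ p : ℕ, p.Prime → p ∣ n → IsUnit (p : R)) : IsUnit (n : R) := by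
  induction n using induction_on_primes with
  | zero => exact absurd rfl hn
  | one => simp
  | prime_mul p a hp ih =>
    rw [Nat.cast_mul]
    exact (h p hp (dvd_mul_right p a)).mul
      (ih (right_ne_zero_of_mul hn) fun q hq hqa => h q hq (hqa.mul_left p))

/-! ### Two-periodic exactness for a cyclic group -/

section Cyclic

variable {R D : Type*} [Ring R] [AddCommGroup D] [Module R D] {γ : Module.End R D} {σ : D →+ D}
  {p : ℕ}

/-- The hypothesis on σ writes the identity as a sum of conjugates of σ, as in Higman's criterion.
On a fixed vector x it reads x = N(σ x), up to a power of γ. -/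
theorem ker_sub_one_eq_range_geom_sum (hγ : γ ^ p = 1)
    (hσ : ∀ x, ∑ k ∈ Finset.range p, (γ ^ (p - k)) (σ ((γ ^ k) x)) = x) :
    LinearMap.ker (γ - 1) = LinearMap.range (∑ k ∈ Finset.range p, γ ^ k) := by
  apply le_antisymm
  · intro x hx
    have hx : γ x = x := by simpa [sub_eq_zero] using hx
    have hpow : ∀ k, (γ ^ k) x = x := fun k => by
      induction k with
      | zero => rfl
      | succ k ih => rw [pow_succ, Module.End.mul_apply, hx, ih]
    -- The extra γ matches exponents p - k, running over 1, …, p, with the exponents 0, …, p - 1 of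
    -- the norm.
    refine ⟨γ (σ x), ?_⟩
    conv_rhs => rw [← hσ x]
    rw [LinearMap.sum_apply, ← Finset.sum_range_reflect]
    refine Finset.sum_congr rfl fun k hk => ?_
    rw [Finset.mem_range] at hk
    rw [hpow, ← Module.End.mul_apply, ← pow_succ]
    congr 3
    omega
  · rintro _ ⟨x, rfl⟩
    rw [LinearMap.mem_ker, ← Module.End.mul_apply, mul_geom_sum, hγ, sub_self]
    rfl

/-- If Nx = 0, then ∑ σ(γ^k x) = σ(Nx) = 0 may be subtracted from the formula for x, leaving terms
in the image of γ^(p-k) - 1, hence of γ - 1. -/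
theorem ker_geom_sum_eq_range_sub_one (hγ : γ ^ p = 1)
    (hσ : ∀ x, ∑ k ∈ Finset.range p, (γ ^ (p - k)) (σ ((γ ^ k) x)) = x) :
    LinearMap.ker (∑ k ∈ Finset.range p, γ ^ k) = LinearMap.range (γ - 1) := by
  apply le_antisymm
  · intro x hx
    have h₀ : ∑ k ∈ Finset.range p, σ ((γ ^ k) x) = 0 := by
      rw [← map_sum, ← LinearMap.sum_apply, LinearMap.mem_ker.1 hx, map_zero]
    have h₁ : x = ∑ k ∈ Finset.range p, (γ ^ (p - k) - 1) (σ ((γ ^ k) x)) := by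
      simp only [LinearMap.sub_apply, Finset.sum_sub_distrib, hσ, Module.End.one_apply, h₀,
        sub_zero]
    rw [h₁]
    refine Submodule.sum_mem _ fun k _ => ?_
    rw [← mul_geom_sum]
    exact ⟨_, rfl⟩
  · rintro _ ⟨x, rfl⟩
    rw [LinearMap.mem_ker, ← Module.End.mul_apply, geom_sum_mul, hγ, sub_self]
    rfl

theorem geom_sum_apply_sub (hγ : γ ^ p = 1) (x : D) :
    (∑ k ∈ Finset.range p, γ ^ k) (γ x - x) = 0 := by
  have := LinearMap.congr_fun (geom_sum_mul γ p) x
  rwa [hγ, sub_self] at this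

end Cyclic

namespace ContractedBasis

open TensorProduct CategoryTheory Abelian

/-! ### Vanishing of Ext out of standard modules -/

section ExtVanishing

variable {K : Type u} {A : Type (max u v)} {M : Type*} [CommRing K] [Ring A] [Algebra K A]
  [Monoid M] [Fintype M] (b : ContractedBasis K A M) (hM : IsRegularMonoid M)
  {V : Type (max u v w)} [AddCommGroup V] [Module K V] [Module.Projective K V]
  {Y : ModuleCat.{max u v w} A}
include hM

/-- Dimension shift along the projective Af ⊗ V: its kernel is filtered by the standard modules in
the hypothesis. -/
theorem subsingleton_ext_standard_succ {f : M} (hf : IsIdempotentElem f)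
    (h : ∀ y ∈ strictlyBelow f, IsIdempotentElem y →
      ∀ n, Subsingleton (Ext (ModuleCat.of A (b.standard y ⊗[K] V)) Y n)) (n : ℕ) :
    Subsingleton (Ext (ModuleCat.of A (b.standard f ⊗[K] V)) Y (n + 1)) := by
  have := b.projective_sub_leftIdealOf hf
  refine subsingleton_ext_right
    (b.sub_tensor_injective V (isLeftStable_strictlyBelow f) (strictlyBelow_subset f))
    (b.sub_tensor_exact V (strictlyBelow_subset f)) (b.sub_tensor_surjective V) ?_
    (HasProjectiveDimensionLT.subsingleton
      (hX := hasProjectiveDimensionLT_of_projective (le_refl 1)) _ 1 _ (by omega) _)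
  exact b.filtration_induction hM (fun X => Subsingleton (Ext X Y n))
    (fun X _ _ _ => HasProjectiveDimensionLT.subsingleton
      (hX := hasProjectiveDimensionLT_of_subsingleton 0) _ 0 n (Nat.zero_le n) Y)
    (fun X₁ X₂ X₃ _ _ _ _ _ _ f g hf hfg hg h₁ h₃ =>
      subsingleton_ext_middle hf hfg hg h₁ h₃) (isLeftStable_strictlyBelow f)
    fun y hy _ hy' => h y hy hy' n

/-- Standard modules at idempotents in an ideal have no extensions with modules annihilated by that
ideal. -/
theorem subsingleton_ext_standard {f₀ : M}
    (hY : ∀ y, f₀ ∉ principalIdeal y → ∀ x : Y, b.toAlg y • x = 0) {f : M}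
    (hf : IsIdempotentElem f) (hff₀ : f₀ ∉ principalIdeal f) (n : ℕ) :
    Subsingleton (Ext (ModuleCat.of A (b.standard f ⊗[K] V)) Y n) := by
  induction hk : (principalIdeal f).ncard using Nat.strong_induction_on generalizing f n with
  | _ k ih =>
  cases n with
  | zero =>
    refine subsingleton_ext_zero fun φ => LinearMap.ext fun x => ?_
    induction x using b.std_tensor_induction with
    | h0 => simp
    | hadd x y hx hy => rw [map_add, hx, hy, map_add]
    | hmk y hy hy' v =>
      -- As y = yf, φ(y ⊗ v) = y φ(f ⊗ v), and y kills Y.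
      rw [← mul_idempotent_of_mem_leftIdealOf hf hy,
        ← b.smul_stdMk y (mem_leftIdealOf_self f), ← smul_tmul', map_smul,
        LinearMap.zero_apply]
      exact hY y (fun h => hff₀ (principalIdeal_subset (isMonoidIdeal_principalIdeal f)
        (leftIdealOf_subset_principalIdeal f hy) h)) _
  | succ n =>
    refine b.subsingleton_ext_standard_succ hM hf (fun y hy hy' m => ?_) n
    have hyf : principalIdeal y ⊆ principalIdeal f :=
      principalIdeal_subset (isMonoidIdeal_principalIdeal f)
        (leftIdealOf_subset_principalIdeal f hy.1)
    refine ih _ ?_ hy' (fun h => hff₀ (hyf h)) m rfl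
    rw [← hk]
    refine Set.ncard_lt_ncard ⟨hyf, fun h => ?_⟩ (Set.toFinite _)
    exact notMem_principalIdeal_of_mem_strictlyBelow hy (h (mem_principalIdeal_self f))

/-- Here Hom may survive, since f need not kill Y; by stability everything strictly below f falls
under the full vanishing, which gives positive degrees. -/
theorem subsingleton_ext_standard_self {f : M}
    (hY : ∀ y, f ∉ principalIdeal y → ∀ x : Y, b.toAlg y • x = 0)
    (hf : IsIdempotentElem f) (n : ℕ) :
    Subsingleton (Ext (ModuleCat.of A (b.standard f ⊗[K] V)) Y (n + 1)) :=
  b.subsingleton_ext_standard_succ hM hf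
    (fun _ hy hy' m => b.subsingleton_ext_standard hM hY hy'
      (notMem_principalIdeal_of_mem_strictlyBelow hy) m) n

end ExtVanishing

/-! ### Free action of a cyclic subgroup on the basis of a standard module -/

section Transversal

variable {K A M : Type*} [CommRing K] [Ring A] [Algebra K A] [Monoid M]
  [Fintype M] (b : ContractedBasis K A M) {e : M} {he : IsIdempotentElem e}

/-- The cyclic subgroup generated by `g` has a transversal in the elements that generate the same
left ideal as `e`. -/
theorem exists_transversal (g : MaximalSubgroup he) :
    ∃ U : Set M, ∀ y ∈ leftIdealOf e, e ∈ leftIdealOf y →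
      ∃ k < orderOf g, ∀ j < orderOf g, y * (g ^ j).val ∈ U ↔ j = k := by
  have hp : 0 < orderOf g := orderOf_pos g
  let orb : M → Set M := fun y => {z | ∃ k : ℕ, z = y * (g ^ k).val}
  have horb : ∀ y i, orb (y * (g ^ i).val) = orb y := by
    intro y i
    apply Set.Subset.antisymm
    · rintro _ ⟨k, rfl⟩
      exact ⟨i + k, by rw [pow_add, MaximalSubgroup.val_mul, mul_assoc]⟩
    · rintro _ ⟨k, rfl⟩
      -- The power g^(i(o-1)), with o the order of g, stands for g^(-i).
      refine ⟨i * (orderOf g - 1) + k, ?_⟩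
      rw [mul_assoc, ← MaximalSubgroup.val_mul, ← pow_add, ← add_assoc]
      congr 2
      obtain ⟨q, hq⟩ : ∃ q, orderOf g = q + 1 := ⟨orderOf g - 1, by omega⟩
      rw [show i + i * (orderOf g - 1) = orderOf g * i by rw [hq]; simp; ring, pow_add, pow_mul,
        pow_orderOf_eq_one, one_pow, one_mul]
  have hne : ∀ y, (orb y).Nonempty := fun y => ⟨_, 0, rfl⟩
  let rep : Set M → M := fun S => Classical.epsilon (· ∈ S)
  have hrep : ∀ y, rep (orb y) ∈ orb y := fun y => Classical.epsilon_spec (hne y)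
  refine ⟨{y | rep (orb y) = y}, fun y hy hy' => ?_⟩
  obtain ⟨k, hk⟩ := hrep y
  refine ⟨k % orderOf g, Nat.mod_lt _ hp, fun j hj => ?_⟩
  rw [Set.mem_ofPred_eq, horb, hk]
  constructor
  · intro h
    -- Freeness: from e = my, the factor y cancels in y g^k = y g^j.
    obtain ⟨m, hm⟩ := hy'
    have h' : (g ^ k).val = (g ^ j).val := by
      rw [← (g ^ k).idem_mul_val, ← (g ^ j).idem_mul_val]
      simp only [hm, mul_assoc, h]
    have := MaximalSubgroup.val_injective h'
    rw [pow_inj_mod, Nat.mod_eq_of_lt hj] at this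
    exact this.symm
  · rintro rfl
    rw [pow_mod_orderOf]

theorem proj_toAlg_of_mem {U : Set M} {x : M} (hx : x ∈ U) :
    b.proj U (b.toAlg x) = b.toAlg x := by
  refine b.ext_coef fun y => ?_
  by_cases hy : y ∈ U
  · exact b.coef_proj_of_mem hy _
  · rw [b.coef_proj_of_notMem hy, b.coef_ne y x fun h => hy (h ▸ hx)]

theorem proj_toAlg_of_notMem {U : Set M} {x : M} (hx : x ∉ U) : b.proj U (b.toAlg x) = 0 := by
  refine b.ext_coef fun y => ?_
  by_cases hy : y ∈ U
  · rw [b.coef_proj_of_mem hy, b.coef_ne y x fun h => hx (h ▸ hy), map_zero]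
  · rw [b.coef_proj_of_notMem hy, map_zero]

/-- The projection of the standard module at `e` to the span of a set of monoid elements. -/
noncomputable def stdProj (e : M) (U : Set M) : b.standard e →ₗ[K] b.standard e :=
  b.subquotLift (b.toSubquot (strictlyBelow e) (leftIdealOf e) ∘ₗ b.proj U) fun a ha => by
    refine b.toSubquot_eq_zero (isLeftStable_leftIdealOf e) (strictlyBelow_subset e)
      (b.mem_sub_of_coef fun x hx => ?_)
    by_cases hU : x ∈ U
    · rw [b.coef_proj_of_mem hU, b.coef_eq_zero (isLeftStable_strictlyBelow e) ha hx]
    · exact b.coef_proj_of_notMem hU a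

theorem stdProj_of_mem {U : Set M} {y : M} (hy : y ∈ leftIdealOf e) (hU : y ∈ U) :
    b.stdProj e U (b.stdMk e y) = b.stdMk e y := by
  rw [stdProj, b.subquotLift_toSubquot _ _ (isLeftStable_leftIdealOf e) (b.toAlg_mem_sub hy),
    LinearMap.comp_apply, b.proj_toAlg_of_mem hU]

theorem stdProj_of_notMem {U : Set M} {y : M} (hy : y ∈ leftIdealOf e) (hU : y ∉ U) :
    b.stdProj e U (b.stdMk e y) = 0 := by
  rw [stdProj, b.subquotLift_toSubquot _ _ (isLeftStable_leftIdealOf e) (b.toAlg_mem_sub hy),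
    LinearMap.comp_apply, b.proj_toAlg_of_notMem hU, map_zero]

variable (V : Type*) [AddCommGroup V] [Module K V]

/-- Right multiplication by an element of the maximal subgroup on a tensored standard module. -/
noncomputable def groupEnd (g : MaximalSubgroup he) : Module.End A (b.standard e ⊗[K] V) :=
  AlgebraTensorModule.rTensor K V (b.groupMul g)

variable {V}

theorem groupEnd_pow_tmul (g : MaximalSubgroup he) (k : ℕ) {y : M} (hy : y ∈ leftIdealOf e)
    (v : V) : (b.groupEnd V g ^ k) (b.stdMk e y ⊗ₜ v) = b.stdMk e (y * (g ^ k).val) ⊗ₜ v := by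
  induction k with
  | zero =>
    rw [pow_zero, pow_zero, MaximalSubgroup.val_one, mul_idempotent_of_mem_leftIdealOf he hy]
    rfl
  | succ k ih =>
    rw [pow_succ', Module.End.mul_apply, ih, groupEnd, AlgebraTensorModule.rTensor_tmul,
      b.groupMul_stdMk g ((g ^ k).mul_val_mem_leftIdealOf y), mul_assoc,
      ← MaximalSubgroup.val_mul, pow_succ]

theorem groupEnd_pow_orderOf (g : MaximalSubgroup he) : b.groupEnd V g ^ orderOf g = 1 := by
  refine LinearMap.ext fun x => ?_
  induction x using b.std_tensor_induction with
  | h0 => simp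
  | hadd x y hx hy => rw [map_add, hx, hy, map_add]
  | hmk y hy hy' v =>
    rw [b.groupEnd_pow_tmul g _ hy, pow_orderOf_eq_one, MaximalSubgroup.val_one,
      mul_idempotent_of_mem_leftIdealOf he hy]
    rfl

/-- σ projects onto the span of a transversal: exactly one g^k carries a basis element into it, and
g^(o-k), with o the order of g, carries it back. -/
theorem exists_groupEnd_splitting (g : MaximalSubgroup he) :
    ∃ σ : b.standard e ⊗[K] V →+ b.standard e ⊗[K] V,
      ∀ x, ∑ k ∈ Finset.range (orderOf g),
        (b.groupEnd V g ^ (orderOf g - k)) (σ ((b.groupEnd V g ^ k) x)) = x := by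
  obtain ⟨U, hU⟩ := exists_transversal g
  refine ⟨((b.stdProj e U).rTensor V).toAddMonoidHom, fun x => ?_⟩
  induction x using b.std_tensor_induction with
  | h0 => simp
  | hadd x y hx hy => simp only [map_add, Finset.sum_add_distrib, hx, hy]
  | hmk y hy hy' v =>
    obtain ⟨k, hk, hkU⟩ := hU y hy hy'
    rw [Finset.sum_eq_single_of_mem k (Finset.mem_range.2 hk)]
    · rw [b.groupEnd_pow_tmul g k hy]
      change (b.groupEnd V g ^ _) (b.stdProj e U _ ⊗ₜ v) = _
      rw [b.stdProj_of_mem ((g ^ k).mul_val_mem_leftIdealOf y) ((hkU k hk).2 rfl),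
        b.groupEnd_pow_tmul g _ ((g ^ k).mul_val_mem_leftIdealOf y), mul_assoc,
        ← MaximalSubgroup.val_mul, ← pow_add, Nat.add_sub_cancel' hk.le, pow_orderOf_eq_one,
        MaximalSubgroup.val_one, mul_idempotent_of_mem_leftIdealOf he hy]
    · intro j hj hjk
      rw [b.groupEnd_pow_tmul g j hy]
      change (b.groupEnd V g ^ _) (b.stdProj e U _ ⊗ₜ v) = _
      rw [b.stdProj_of_notMem ((g ^ j).mul_val_mem_leftIdealOf y)
        (fun h => hjk ((hkU j (Finset.mem_range.1 hj)).1 h)), zero_tmul, map_zero]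

end Transversal

/-! ### Invertibility of the group orders -/

section LowerBound

section

variable {K A M : Type*} [CommRing K] [Ring A] [Algebra K A] [Monoid M]
  [Fintype M] (b : ContractedBasis K A M) {e : M} {he : IsIdempotentElem e}

/-- The coordinate at `e` on the standard module at `e`, tensored with a copy of `K`. -/
noncomputable def stdCoef (e : M) : b.standard e ⊗[K] ULift.{t} K →ₗ[K] K :=
  TensorProduct.lift ((LinearMap.lsmul K K).compl₁₂
    (b.subquotLift (b.coef e) fun _ ha =>
      b.coef_eq_zero (isLeftStable_strictlyBelow e) ha fun h => h.2 (mem_leftIdealOf_self e))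
    ULift.moduleEquiv.toLinearMap)

theorem stdCoef_tmul {y : M} (hy : y ∈ leftIdealOf e) (k : ULift.{t} K) :
    b.stdCoef e (b.stdMk e y ⊗ₜ k) = b.coef e (b.toAlg y) * k.down := by
  rw [stdCoef, TensorProduct.lift.tmul, LinearMap.compl₁₂_apply,
    b.subquotLift_toSubquot _ _ (isLeftStable_leftIdealOf e) (b.toAlg_mem_sub hy)]
  rfl

/-- The coefficient at the identity of G_e is a trace: ug = e exactly when gu = e. -/
theorem coef_conj (g : MaximalSubgroup he) {y : M} (hy : y ∈ leftIdealOf e) :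
    b.coef e (b.toAlg (e * y * g.val)) = b.coef e (b.toAlg (g.val * (e * y))) := by
  have hye := mul_idempotent_of_mem_leftIdealOf he hy
  have hiff : e * y * g.val = e ↔ g.val * (e * y) = e := by
    constructor
    · intro h
      have : e * y = (g⁻¹).val := by
        calc e * y = e * y * (g.val * (g⁻¹).val) := by rw [g.val_mul_val_inv, mul_assoc, hye]
          _ = e * y * g.val * (g⁻¹).val := (mul_assoc _ _ _).symm
          _ = e * (g⁻¹).val := by rw [h]
          _ = (g⁻¹).val := (g⁻¹).idem_mul_val
      rw [this, g.val_mul_val_inv]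
    · intro h
      have : e * y = (g⁻¹).val := by
        have h' := congrArg ((g⁻¹).val * ·) h
        simp only [← mul_assoc, ← MaximalSubgroup.val_mul, inv_mul_cancel,
          MaximalSubgroup.val_one, MaximalSubgroup.val_mul_idem] at h'
        exact h'
      rw [this, ← MaximalSubgroup.val_mul, inv_mul_cancel, MaximalSubgroup.val_one]
  by_cases h : e * y * g.val = e
  · rw [h, hiff.1 h]
  · rw [b.coef_ne _ _ (Ne.symm h), b.coef_ne _ _ (Ne.symm fun h' => h (hiff.2 h'))]

/-- The trace property trades right multiplication by g^k for left multiplication, with which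
A-linear maps commute. -/
theorem stdCoef_groupEnd_pow (g : MaximalSubgroup he) (k : ℕ) (x : b.standard e ⊗[K] ULift.{t} K) :
    b.stdCoef e (b.toAlg e • (b.groupEnd _ g ^ k) x) =
      b.stdCoef e (b.toAlg (g ^ k).val • b.toAlg e • x) := by
  induction x using b.std_tensor_induction (e := e) (V := ULift.{t} K) with
  | h0 => simp
  | hadd x y hx hy => simp only [map_add, smul_add, hx, hy]
  | hmk y hy hy' v =>
    have hey := isLeftStable_leftIdealOf e e hy
    have hyk := (g ^ k).mul_val_mem_leftIdealOf y
    rw [b.groupEnd_pow_tmul g k hy, smul_tmul', smul_tmul', smul_tmul', b.smul_stdMk e hyk,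
      b.smul_stdMk e hy, b.smul_stdMk _ hey, b.stdCoef_tmul (isLeftStable_leftIdealOf e e hyk),
      b.stdCoef_tmul (isLeftStable_leftIdealOf e _ hey), ← mul_assoc, b.coef_conj _ hy]

/-- If the kernel of the norm of `g` is a direct summand of the tensored standard module at `e`, then
the order of `g` is invertible. -/
theorem isUnit_orderOf_of_projection (heZ : e ∉ b.zeroSet) (g : MaximalSubgroup he)
    (r : b.standard e ⊗[K] ULift.{t} K →ₗ[A] b.standard e ⊗[K] ULift.{t} K)
    (hr : ∀ x, (∑ k ∈ Finset.range (orderOf g), b.groupEnd (ULift.{t} K) g ^ k) (r x) = 0)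
    (hr' : ∀ x, (∑ k ∈ Finset.range (orderOf g), b.groupEnd (ULift.{t} K) g ^ k) x = 0 →
      r x = x) :
    IsUnit (orderOf g : K) := by
  set N := ∑ k ∈ Finset.range (orderOf g), b.groupEnd (ULift.{t} K) g ^ k with hN
  have hself := mem_leftIdealOf_self e
  let x₀ : b.standard e ⊗[K] ULift.{t} K := b.stdMk e e ⊗ₜ ⟨1⟩
  -- c is the component of the generator e in the complement of ker N. Thus Nc = Nx₀ has coefficient
  -- 1 at e, while gc = c makes it the order of g times the coefficient of c.
  let c := x₀ - r x₀
  have hex₀ : b.toAlg e • x₀ = x₀ := by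
    rw [smul_tmul', b.smul_stdMk e hself, congrArg (b.stdMk e) he.eq]
  have hec : b.toAlg e • c = c := by
    rw [smul_sub, ← map_smul, hex₀]
  have hγx₀ : b.groupEnd _ g x₀ = b.toAlg g.val • x₀ := by
    have := b.groupEnd_pow_tmul g 1 hself (⟨1⟩ : ULift.{t} K)
    rw [pow_one, pow_one, g.idem_mul_val] at this
    rw [this, smul_tmul', b.smul_stdMk _ hself, g.val_mul_idem]
  -- γx₀ - x₀ lies in ker N, so r fixes it; and γx₀ = gx₀ because x₀ comes from e.
  have hgc : b.toAlg g.val • c = c := by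
    have h := hr' (b.groupEnd _ g x₀ - x₀)
      (geom_sum_apply_sub (b.groupEnd_pow_orderOf g) x₀)
    rw [hγx₀, map_sub, map_smul] at h
    rw [sub_eq_sub_iff_add_eq_add] at h
    rw [smul_sub, sub_eq_sub_iff_add_eq_add, ← h, add_comm]
  have hgkc : ∀ k : ℕ, b.toAlg (g ^ k).val • c = c := fun k => by
    induction k with
    | zero => exact hec
    | succ k ih => rw [pow_succ, MaximalSubgroup.val_mul, map_mul, mul_smul, hgc, ih]
  have h₁ : b.stdCoef e (N c) = orderOf g * b.stdCoef e c := by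
    rw [hN, LinearMap.sum_apply, map_sum, Finset.sum_congr rfl (g := fun _ => b.stdCoef e c),
      Finset.sum_const, Finset.card_range, nsmul_eq_mul]
    intro k _
    have := b.stdCoef_groupEnd_pow g k c
    rwa [← map_smul, hec, hgkc] at this
  have h₂ : b.stdCoef e (N x₀) = 1 := by
    rw [hN, LinearMap.sum_apply, map_sum,
      Finset.sum_eq_single_of_mem 0 (Finset.mem_range.2 (orderOf_pos g))]
    · rw [b.groupEnd_pow_tmul g 0 hself, b.stdCoef_tmul ((g ^ 0).mul_val_mem_leftIdealOf e),
        pow_zero, MaximalSubgroup.val_one, he.eq, b.coef_self e heZ, one_mul]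
    · intro k hk hk0
      rw [b.groupEnd_pow_tmul g k hself, b.stdCoef_tmul ((g ^ k).mul_val_mem_leftIdealOf e),
        (g ^ k).idem_mul_val, b.coef_ne, zero_mul]
      intro h
      have : g ^ k = 1 := MaximalSubgroup.val_injective h.symm
      exact pow_ne_one_of_lt_orderOf hk0 (Finset.mem_range.1 hk) this
  have h₃ : N c = N x₀ := by rw [map_sub, hr, sub_zero]
  exact IsUnit.of_mul_eq_one _ (h₁.symm.trans ((congrArg _ h₃).trans h₂))

end

variable {K : Type u} {A : Type (max u v)} {M : Type*} [CommRing K] [Ring A] [Algebra K A]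
  [Monoid M] [Fintype M] (b : ContractedBasis K A M) (hM : IsRegularMonoid M)
include hM

/-- If all modules over a contracted algebra of a finite regular monoid have bounded projective
dimension, then the orders of the maximal subgroups at nonzero idempotents are invertible. -/
theorem isUnit_card_maximalSubgroup {e : M} (he : IsIdempotentElem e) (heZ : e ∉ b.zeroSet)
    {d : ℕ} (hd : ∀ X : ModuleCat.{max u v w} A, HasProjectiveDimensionLT X d) :
    IsUnit (Nat.card (MaximalSubgroup he) : K) := by
  refine isUnit_natCast_of_prime_dvd Nat.card_pos.ne' fun p hp hpG => ?_
  have : Fact p.Prime := ⟨hp⟩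
  obtain ⟨g, rfl⟩ := exists_prime_orderOf_dvd_card' p hpG
  obtain ⟨σ, hσ⟩ := b.exists_groupEnd_splitting (V := ULift.{max v w} K) g
  have hγ := b.groupEnd_pow_orderOf (V := ULift.{max v w} K) g
  -- Applied with φ = N and ψ = γ - 1; ker N lies in Δ_e ⊗ K, so it is killed by whatever kills that
  -- module.
  obtain ⟨r, hr, hr'⟩ := exists_projection_ker_of_periodic
    (ker_geom_sum_eq_range_sub_one hγ hσ) (ker_sub_one_eq_range_geom_sum hγ hσ) hd
    (fun n => b.subsingleton_ext_standard_self hM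
      (fun y hy x => Subtype.ext (b.smul_std_tensor_eq_zero hy _)) he n)
  exact b.isUnit_orderOf_of_projection heZ g r hr hr'

end LowerBound

end ContractedBasis

/-! ### Monoid algebras, contracted monoid algebras and the base ring -/

namespace ContractedBasis

open TensorProduct CategoryTheory

section Instances

variable (K M : Type*) [CommRing K]

/-- The coefficient functionals of a monoid algebra. -/
noncomputable def coeffFunctional [Monoid M] (x : M) : MonoidAlgebra K M →ₗ[K] K where
  toFun a := a.coeff x
  map_add' _ _ := rfl
  map_smul' _ _ := rfl

theorem coeffFunctional_apply [Monoid M] (x : M) (a : MonoidAlgebra K M) :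
    coeffFunctional K M x a = a.coeff x := rfl

theorem sum_coeffFunctional [Monoid M] [Fintype M] (a : MonoidAlgebra K M) :
    ∑ x, coeffFunctional K M x a • MonoidAlgebra.of K M x = a := by
  classical
  refine MonoidAlgebra.coeff_injective (Finsupp.ext fun y => ?_)
  rw [MonoidAlgebra.coeff_sum, Finsupp.finsetSum_apply, Finset.sum_eq_single y]
  · simp [coeffFunctional_apply]
  · intro x _ hx
    simp [hx]
  · simp

/-- The standard basis of a monoid algebra. -/
noncomputable def monoidAlgebra [Monoid M] [Fintype M] :
    ContractedBasis K (MonoidAlgebra K M) M where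
  toAlg := MonoidAlgebra.of K M
  zeroSet := ∅
  coef := coeffFunctional K M
  zeroSet_stable _ _ hx := hx
  map_zeroSet _ hx := hx.elim
  coef_self x _ := by simp [coeffFunctional_apply]
  coef_ne x y h := by simp [coeffFunctional_apply, h.symm]
  sum_coef := sum_coeffFunctional K M

/-- The coefficient functional of a contracted monoid algebra at a nonzero element. -/
noncomputable def contractedCoeffOfNe [MonoidWithZero M] {x : M} (hx : x ≠ 0) :
    ContractedMonoidAlgebra K M →ₗ[K] K :=
  Submodule.liftQ ((zeroIdeal K M).restrictScalars K) (coeffFunctional K M x) (by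
    rintro _ ⟨k, rfl⟩
    simp [coeffFunctional_apply, Ne.symm hx])

open Classical in
/-- The coefficient functionals of a contracted monoid algebra. -/
noncomputable def contractedCoeff [MonoidWithZero M] (x : M) :
    ContractedMonoidAlgebra K M →ₗ[K] K :=
  if hx : x = 0 then 0 else contractedCoeffOfNe K M hx

theorem contractedCoeff_mk [MonoidWithZero M] {x : M} (hx : x ≠ 0) (a : MonoidAlgebra K M) :
    contractedCoeff K M x (Ideal.Quotient.mk _ a) = coeffFunctional K M x a := by
  rw [contractedCoeff, dif_neg hx]
  rfl

theorem contractedCoeff_zero [MonoidWithZero M] : contractedCoeff K M (0 : M) = 0 := by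
  rw [contractedCoeff, dif_pos rfl]

/-- The standard basis of a contracted monoid algebra. -/
noncomputable def contractedMonoidAlgebra [MonoidWithZero M] [Fintype M] :
    ContractedBasis K (ContractedMonoidAlgebra K M) M where
  toAlg := (Ideal.Quotient.mk (zeroIdeal K M)).toMonoidHom.comp (MonoidAlgebra.of K M)
  zeroSet := {0}
  coef := contractedCoeff K M
  zeroSet_stable m x hx := by
    rw [Set.mem_singleton_iff] at hx ⊢
    rw [hx, mul_zero]
  map_zeroSet x hx := by
    rw [Set.mem_singleton_iff] at hx
    subst hx
    exact Ideal.Quotient.eq_zero_iff_mem.2 ⟨1, rfl⟩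
  coef_self x hx := (contractedCoeff_mk K M hx _).trans (by simp [coeffFunctional_apply])
  coef_ne x y h := by
    by_cases hx : x = 0
    · rw [hx, contractedCoeff_zero, LinearMap.zero_apply]
    · exact (contractedCoeff_mk K M hx _).trans (by simp [coeffFunctional_apply, h.symm])
  sum_coef a := by
    obtain ⟨a, rfl⟩ := Ideal.Quotient.mk_surjective a
    conv_rhs => rw [← sum_coeffFunctional K M a, map_sum]
    refine Finset.sum_congr rfl fun x _ => ?_
    by_cases hx : x = 0
    · subst hx
      have h0 : Ideal.Quotient.mk (zeroIdeal K M) (coeffFunctional K M (0 : M) a •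
          MonoidAlgebra.of K M 0) = 0 :=
        Ideal.Quotient.eq_zero_iff_mem.2 ⟨coeffFunctional K M (0 : M) a, by simp⟩
      rw [h0, contractedCoeff_zero, LinearMap.zero_apply, zero_smul]
    · rw [contractedCoeff_mk K M hx]
      rfl

end Instances

variable {K : Type u} {A : Type (max u v)} {M : Type*} [CommRing K] [Ring A] [Algebra K A]
  [Monoid M] [Fintype M] (b : ContractedBasis K A M)

/-- The base ring inherits bounds for projective dimensions from a contracted algebra. -/
theorem hasProjectiveDimensionLT_base (h1 : (1 : M) ∉ b.zeroSet) {d : ℕ}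
    (hd : ∀ X : ModuleCat.{max u v w} A, HasProjectiveDimensionLT X (d + 1))
    (V : ModuleCat.{max u v w} K) : HasProjectiveDimensionLT V (d + 1) := by
  have := b.projective
  have h := hasProjectiveDimensionLT_restrictScalars (K := K) (A := A) d (A ⊗[K] V)
    (hd (ModuleCat.of A (A ⊗[K] V)))
  -- v ↦ 1 ⊗ v is split by the coefficient at 1, which is 1 on 1 because 1 is outside the zero set.
  refine hasProjectiveDimensionLT_retract (X₁ := V) (i := TensorProduct.mk K A V 1)
    (r := TensorProduct.lift ((LinearMap.lsmul K V).comp (b.coef 1))) ?_ h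
  ext v
  have : b.coef 1 1 = 1 := by simpa using b.coef_self 1 h1
  simp [this]

variable {b}

/-- The case i = n of the induction: elements of depth at least n are zero in A and so kill every
module. -/
theorem hasProjectiveDimensionLT_of_isDepth (hM : IsRegularMonoid M) {d : M → ℕ} {n : ℕ}
    (hd : b.IsDepth d n) (hn : 1 ≤ n)
    (hG : ∀ x ∉ b.zeroSet, ∃ (e : M) (he : IsIdempotentElem e),
      principalIdeal e = principalIdeal x ∧ IsUnit (Nat.card (MaximalSubgroup he) : K))
    {g : ℕ} (hg : ∀ V : ModuleCat.{max u v w} K, HasProjectiveDimensionLT V (g + 1))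
    (X : ModuleCat.{max u v w} A) :
    HasProjectiveDimensionLT X (2 * (n - 1) + g + 1) := by
  let : Module K X := Module.restrictScalars K A X
  have : IsScalarTower K A X := IsScalarTower.restrictScalars K A X
  have h := hasProjectiveDimensionLT_of_depth hM hd hn hG hg n le_rfl X fun y hy x => by
    rw [b.map_zeroSet y ((hd.mem_zeroSet y).2 hy), zero_smul]
  rw [if_neg (by omega)] at h
  exact hasProjectiveDimensionLT_mono h (by omega)

end ContractedBasis

/-! ### Depth functions -/

section Depth

variable {M : Type*} [Monoid M]

/-- The depth function of a principal series that consists of principal ideals. -/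
theorem IsPrincipalSeries.exists_depth {n : ℕ} {e : Fin (n + 1) → M}
    (h : IsPrincipalSeries fun i => principalIdeal (e i)) :
    ∃ d : M → ℕ, (∀ x, d x < n + 1) ∧ ∀ x (i : Fin (n + 1)), x ∈ principalIdeal (e i) ↔ i ≤ d x := by
  classical
  let P : M → ℕ → Prop := fun x k => ∃ hk : k < n + 1, x ∈ principalIdeal (e ⟨k, hk⟩)
  have h0 : ∀ x, P x 0 := fun x => by
    have := h.zero_eq
    refine ⟨Nat.succ_pos n, ?_⟩
    rw [show (⟨0, Nat.succ_pos n⟩ : Fin (n + 1)) = 0 from rfl, this]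
    trivial
  refine ⟨fun x => Nat.findGreatest (P x) n, fun x => Nat.lt_succ_of_le (Nat.findGreatest_le n),
    fun x i => ⟨fun hx => Nat.le_findGreatest (Nat.le_of_lt_succ i.2) ⟨i.2, hx⟩, fun hi => ?_⟩⟩
  obtain ⟨hk, hx⟩ := Nat.findGreatest_spec (Nat.zero_le n) (h0 x)
  exact h.strictAnti.antitone (show i ≤ ⟨_, hk⟩ from hi) hx

/-- MxM together with the members of the series below level i is an ideal comparable with every
member, hence a member; containing x, it must be the one at level i. -/
theorem IsPrincipalSeries.principalIdeal_eq {n : ℕ} {e : Fin (n + 1) → M}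
    (h : IsPrincipalSeries fun i => principalIdeal (e i)) {x : M} {i : Fin (n + 1)}
    (hxi : ∀ j, x ∈ principalIdeal (e j) ↔ j ≤ i) : principalIdeal x = principalIdeal (e i) := by
  have hx : x ∈ principalIdeal (e i) := (hxi i).2 le_rfl
  have hsub : principalIdeal x ⊆ principalIdeal (e i) := principalIdeal_subset (h.isIdeal i) hx
  refine hsub.antisymm (principalIdeal_subset (isMonoidIdeal_principalIdeal x) ?_)
  let J : Set M := principalIdeal x ∪ {y | ∃ j, i < j ∧ y ∈ principalIdeal (e j)}
  have hJ : IsMonoidIdeal J :=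
    { nonempty := ⟨x, Or.inl (mem_principalIdeal_self x)⟩
      mul_mem_left := fun m y hy => hy.imp
        (fun hy => (isMonoidIdeal_principalIdeal x).mul_mem_left m hy)
        fun ⟨j, hj, hy⟩ => ⟨j, hj, (h.isIdeal j).mul_mem_left m hy⟩
      mul_mem_right := fun m y hy => hy.imp
        (fun hy => (isMonoidIdeal_principalIdeal x).mul_mem_right m hy)
        fun ⟨j, hj, hy⟩ => ⟨j, hj, (h.isIdeal j).mul_mem_right m hy⟩ }
  have hJi : J ⊆ principalIdeal (e i) := by
    rintro y (hy | ⟨j, hj, hy⟩)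
    · exact hsub hy
    · exact h.strictAnti.antitone hj.le hy
  obtain ⟨k, hk⟩ := h.unrefinable J hJ fun j => by
    rcases le_or_gt j i with hj | hj
    · exact Or.inl (hJi.trans (h.strictAnti.antitone hj))
    · exact Or.inr fun y hy => Or.inr ⟨j, hj, hy⟩
  have hki : k ≤ i := by
    rw [← hxi, ← hk]
    exact Or.inl (mem_principalIdeal_self x)
  have hei : e i ∈ J := by
    rw [hk]
    exact h.strictAnti.antitone hki (mem_principalIdeal_self (e i))
  rcases hei with hei | ⟨j, hj, hei⟩
  · exact hei
  · exact absurd (principalIdeal_subset (h.isIdeal j) hei) (h.strictAnti hj).2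

/-- Every finite monoid has a function to the natural numbers that is antitone on ideals and
separates principal ideals. -/
theorem exists_depth (M : Type*) [Monoid M] [Finite M] :
    ∃ d : M → ℕ, (∀ x y, y ∈ principalIdeal x → d x ≤ d y) ∧
      ∀ x y, d x = d y → principalIdeal x = principalIdeal y := by
  obtain ⟨B, ⟨φ⟩⟩ := Finite.exists_equiv_fin (Set M)
  -- Lexicographic: the size of the ideal first, with B the number of subsets of M, then an
  -- arbitrary numbering of subsets to separate ideals of equal size.
  refine ⟨fun x => (Nat.card M - (principalIdeal x).ncard) * B + φ (principalIdeal x),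
    fun x y hy => ?_, fun x y h => ?_⟩
  · have hsub := principalIdeal_subset (isMonoidIdeal_principalIdeal x) hy
    rcases hsub.eq_or_ssubset with heq | hlt
    · simp only [heq, le_refl]
    · have h₁ := Set.ncard_lt_ncard hlt (Set.toFinite _)
      have h₂ := Set.ncard_le_card (principalIdeal x)
      have h₃ : Nat.card M - (principalIdeal x).ncard + 1 ≤
        Nat.card M - (principalIdeal y).ncard := by omega
      have h₄ := Nat.mul_le_mul_right B h₃
      have h₅ := (φ (principalIdeal x)).2
      rw [add_mul, one_mul] at h₄
      simp only
      omega
  · have h' := congrArg (· % B) h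
    simp only [Nat.mul_add_mod_self_right, Nat.mod_eq_of_lt (Fin.is_lt _)] at h'
    exact φ.injective (Fin.ext h')

end Depth

theorem leftGlobalDimension_eq_bot_iff {R : Type u} [Ring R] :
    leftGlobalDimension.{w} R = ⊥ ↔ Subsingleton R := by
  refine ⟨fun h => ?_, fun _ => leftGlobalDimension_of_subsingleton⟩
  have h' : CategoryTheory.projectiveDimension (ModuleCat.of R (ULift.{w} R)) ≤ ⊥ :=
    h ▸ le_iSup (fun X : ModuleCat.{max u w} R => CategoryTheory.projectiveDimension X) _
  rw [le_bot_iff, CategoryTheory.projectiveDimension_eq_bot_iff,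
    ModuleCat.isZero_iff_subsingleton] at h'
  exact (Equiv.ulift.{w} (α := R)).symm.subsingleton

theorem card_maximalSubgroup_zero {M : Type*} [MonoidWithZero M] {e : M}
    (he : IsIdempotentElem e) (h0 : e = 0) : Nat.card (MaximalSubgroup he) = 1 := by
  subst h0
  have : Subsingleton (MaximalSubgroup he) := ⟨fun g h => MaximalSubgroup.val_injective (by
    rw [← g.idem_mul_val, ← h.idem_mul_val, zero_mul, zero_mul])⟩
  exact Nat.card_unique

open ContractedBasis

/-! ### The two parts of the theorem -/

section ContractedAlgebra

variable {K : Type u} [CommRing K] {M : Type v} [MonoidWithZero M] [Finite M]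
  (hM : IsRegularMonoid M)
include hM

theorem leftGlobalDimension_contracted_eq_top {e : M} {he : IsIdempotentElem e}
    (hG : ¬ IsUnit (Nat.card (MaximalSubgroup he) : K)) :
    leftGlobalDimension.{w} (ContractedMonoidAlgebra K M) = ⊤ := by
  have := Fintype.ofFinite M
  by_contra h
  obtain ⟨d, hd⟩ := leftGlobalDimension_lt_top_iff.1 (lt_top_iff_ne_top.2 h)
  -- The maximal subgroup at 0 is trivial, so the obstruction occurs at an idempotent outside the
  -- zero set.
  by_cases h0 : e = 0
  · exact hG (by rw [card_maximalSubgroup_zero he h0, Nat.cast_one]; exact isUnit_one)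
  · exact hG ((contractedMonoidAlgebra K M).isUnit_card_maximalSubgroup hM he h0 hd)

theorem leftGlobalDimension_contracted_le [Nontrivial M] {n : ℕ} {e : Fin (n + 1) → M}
    (he : ∀ i, IsIdempotentElem (e i)) (h : IsPrincipalSeries fun i => principalIdeal (e i))
    (hlast : principalIdeal (e (Fin.last n)) = {0})
    (hG : ∀ i, IsUnit (Nat.card (MaximalSubgroup (he i)) : K)) :
    leftGlobalDimension.{w} (ContractedMonoidAlgebra K M) ≤
      ((2 * (n - 1) : ℕ) : WithBot ℕ∞) + (n : WithBot ℕ∞) * leftGlobalDimension.{max v w} K := by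
  have := Fintype.ofFinite M
  have hn : 1 ≤ n := by
    rw [Nat.one_le_iff_ne_zero]
    rintro rfl
    have h1 : (1 : M) ∈ principalIdeal (e (Fin.last 0)) := by
      have := h.zero_eq
      rw [show Fin.last 0 = 0 from rfl, this]
      trivial
    rw [hlast] at h1
    exact one_ne_zero h1
  obtain ⟨d, hdn, hd⟩ := h.exists_depth
  have hideal : ∀ x, principalIdeal x = principalIdeal (e ⟨d x, hdn x⟩) := fun x =>
    h.principalIdeal_eq fun j => hd x j
  have hdepth : (contractedMonoidAlgebra K M).IsDepth d n :=
    { anti := fun x y hy => by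
        rw [hideal x] at hy
        exact (hd y _).1 hy
      inj := fun x y hxy => by
        rw [hideal x, hideal y]
        simp only [hxy]
      mem_zeroSet := fun x => by
        change x ∈ ({0} : Set M) ↔ _
        rw [← hlast, hd]
        rfl }
  generalize hD : leftGlobalDimension.{max v w} K = D
  induction D with
  | bot =>
    have := leftGlobalDimension_eq_bot_iff.1 hD
    have := Module.subsingleton K (ContractedMonoidAlgebra K M)
    rw [leftGlobalDimension_of_subsingleton]
    exact bot_le
  | coe D =>
    induction D with
    | top =>
      -- Uses n ≠ 0, since 0 * ⊤ = 0.
      have : (n : WithBot ℕ∞) * ((⊤ : ℕ∞) : WithBot ℕ∞) = ⊤ := by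
        have : (n : ℕ∞) * ⊤ = ⊤ := ENat.mul_top (by exact_mod_cast (by omega : n ≠ 0))
        exact_mod_cast congrArg (WithBot.some) this
      rw [this]
      exact le_top
    | coe g =>
      have hg := leftGlobalDimension_le_iff.1 (hD.le : leftGlobalDimension.{max v w} K ≤ (g : ℕ))
      have := leftGlobalDimension_le_iff.2
        (hasProjectiveDimensionLT_of_isDepth hM hdepth hn
          (fun x _ => ⟨_, he _, (hideal x).symm, hG _⟩) hg)
      refine this.trans ?_
      -- The sharper bound obtained, with g in place of n * g, is weakened using n ≥ 1.
      have hle : 2 * (n - 1) + g ≤ 2 * (n - 1) + n * g :=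
        Nat.add_le_add_left (Nat.le_mul_of_pos_left g hn) _
      have hcast := Nat.mono_cast (α := WithBot ℕ∞) hle
      rw [Nat.cast_add (2 * (n - 1)) (n * g), Nat.cast_mul n g] at hcast
      exact hcast

end ContractedAlgebra

theorem leftGlobalDimension_monoidAlgebra_lt_top_iff {K : Type u} [CommRing K] {M : Type v}
    [Monoid M] [Finite M] (hM : IsRegularMonoid M) :
    leftGlobalDimension.{w} (MonoidAlgebra K M) < ⊤ ↔
      leftGlobalDimension.{max v w} K < ⊤ ∧
        ∀ (e : M) (he : IsIdempotentElem e), IsUnit (Nat.card (MaximalSubgroup he) : K) := by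
  have := Fintype.ofFinite M
  constructor
  · intro h
    obtain ⟨d, hd⟩ := leftGlobalDimension_lt_top_iff.1 h
    exact ⟨leftGlobalDimension_lt_top_iff.2
      ⟨d, (monoidAlgebra K M).hasProjectiveDimensionLT_base (fun h => h) hd⟩,
      fun e he => (monoidAlgebra K M).isUnit_card_maximalSubgroup hM he (fun h => h) hd⟩
  · rintro ⟨hK, hG⟩
    obtain ⟨g, hg⟩ := leftGlobalDimension_lt_top_iff.1 hK
    obtain ⟨d, hanti, hinj⟩ := exists_depth M
    -- `∑ x, d x + 1` exceeds every depth, matching the empty zero set.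
    have hdepth : (monoidAlgebra K M).IsDepth d (∑ x, d x + 1) :=
      { anti := hanti
        inj := hinj
        mem_zeroSet := fun x => by
          refine ⟨fun h => h.elim, fun h => ?_⟩
          have := Finset.single_le_sum (f := d) (fun _ _ => Nat.zero_le _) (Finset.mem_univ x)
          omega }
    refine leftGlobalDimension_lt_top_iff.2 ⟨_, hasProjectiveDimensionLT_of_isDepth hM hdepth
      (Nat.le_add_left 1 _) (fun x _ => ?_) hg⟩
    obtain ⟨f, hf, hfx⟩ := hM.exists_idempotent_principalIdeal_eq x
    exact ⟨f, hf, hfx, hG f hf⟩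

theorem theoremt (K : Type u) [CommRing K] :
    (∀ (M : Type v) [MonoidWithZero M] [Finite M] [Nontrivial M], IsRegularMonoid M →
      ∀ (n : ℕ) (e : Fin (n + 1) → M) (he : ∀ i, IsIdempotentElem (e i)),
        IsPrincipalSeries (fun i => principalIdeal (e i)) →
        principalIdeal (e (Fin.last n)) = {0} →
        ((∃ i, ¬ IsUnit (Nat.card (MaximalSubgroup (he i)) : K)) →
          leftGlobalDimension.{w} (ContractedMonoidAlgebra K M) = ⊤) ∧
        ((∀ i, IsUnit (Nat.card (MaximalSubgroup (he i)) : K)) →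
          leftGlobalDimension.{w} (ContractedMonoidAlgebra K M) ≤
            ((2 * (n - 1) : ℕ) : WithBot ℕ∞) + (n : WithBot ℕ∞) * leftGlobalDimension.{max v w} K)) ∧
    (∀ (M : Type v) [Monoid M] [Finite M], IsRegularMonoid M →
      (leftGlobalDimension.{w} (MonoidAlgebra K M) < ⊤ ↔
        leftGlobalDimension.{max v w} K < ⊤ ∧
        ∀ (e : M) (he : IsIdempotentElem e), IsUnit (Nat.card (MaximalSubgroup he) : K))) :=
  ⟨fun _ _ _ _ hM _ _ he hser hlast =>
    ⟨fun ⟨_, hi⟩ => leftGlobalDimension_contracted_eq_top hM hi,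
      leftGlobalDimension_contracted_le hM he hser hlast⟩,
    fun _ _ _ hM => leftGlobalDimension_monoidAlgebra_lt_top_iff hM⟩
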